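/- Let $0<\alpha<1$ and $0<d\le \pi\alpha/8$. For $\xi\ge 1$ put $$g(\tau)=g_\xi(\tau)=\frac{e^{-\xi\,\log(1+e^{\tau})^{1/\alpha}}}{1+e^{-\tau}}$$ (principal branches), so that $\xi^{-\alpha}=\frac1{\Gamma(\alpha+1)}\int_{-\infty}^{\infty} g(\tau)\,d\tau$, and let $$\|g\|_{\mathcal D_d}=\int_{-\infty}^{\infty}|g(t+id)|\,dt+\int_{-\infty}^{\infty}|g(t-id)|\,dt .$$ For $0<\varepsilon<1$ put $$h=\frac{2\pi d}{\log(\varepsilon^{-1})},\qquad \beta=\cos(2d/\alpha),\qquad N_-=\left\lceil\frac{2\pi d}{h^2}\right\rceil,\qquad N_+=\left\lceil\left(\frac{2\pi d\,h^{-\frac{\alpha+1}{\alpha}}}{\beta}\right)^{\alpha}\right\rceil,\qquad N=N_-+N_++1,$$ $$A_\varepsilon(\xi)=\frac{h}{\Gamma(\alpha+1)}\sum_{j=-N_-}^{N_+} g_\xi(jh).$$ Then $\beta\ge\cos(\pi/4)$, $\|g\|_{\mathcal D_d}<\infty$ for every $\xi\ge1$, and: 1. For every $0<\varepsilon<1$,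 $A_\varepsilon$ is an exponential sum with $N$ terms: there are $w_j,b_j>0$, independent of $\xi$, with $A_\varepsilon(\xi)=\sum_{j=1}^{N}w_je^{-b_j\xi}$ for all $\xi\ge 1$. 2. For every $0<\varepsilon<1$ and every $\xi\ge1$, $$|\xi^{-\alpha}-A_\varepsilon(\xi)|\le\frac{1}{\Gamma(\alpha+1)}\left(\frac{\|g\|_{\mathcal D_d}}{1-\varepsilon}+\frac1h+\frac1{\beta h^{1/\alpha}}\right)\varepsilon .$$ 3. For every $0<\varepsilon<e^{-\pi^2/4}$ and every $\xi\ge1$, $$|\xi^{-\alpha}-A_\varepsilon(\xi)|\le\left(\|g\|_{\mathcal D_d}+\frac1h+\frac1{\beta h^{1/\alpha}}\right)\varepsilon$$ and $$|\xi^{-\alpha}-A_\varepsilon(\xi)|\le 2\left[1+\log 2+\frac{\Gamma(\alpha+1)}{\cos(\pi/8)^{\alpha}}+\cos(\pi/4)^{-1}\left(\frac{4\log(\varepsilon^{-1})}{\pi^2\alpha}\right)^{1/\alpha}\right]\varepsilon .$$ 4. As $\varepsilon\to0^+$ (with $\alpha$, $d$ fixed), $N\sim\dfrac{\log^2(1/\varepsilon)}{2\pi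 d}$ and $\log(1/\varepsilon)\sim\sqrt{2\pi dN}$ (the ratios tend to $1$). More precisely, there is a constant $C>0$, depending only on $\alpha$ and $d$, such that for all $0<\varepsilon<e^{-\pi^2/4}$ $$e^{-\sqrt{2\pi dN}}\le\varepsilon\le e^{-\sqrt{2\pi dN}+CN^{\alpha/2}},\qquad \sup_{\xi\ge1}|\xi^{-\alpha}-A_\varepsilon(\xi)|\le C\,e^{-\sqrt{2\pi dN}+CN^{\alpha/2}} ;$$ since $\alpha<1$, $N^{\alpha/2}$ is of lower order than $\sqrt N$. -/

import Mathlib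

namespace SincExpSum

noncomputable section

/-- The integrand `g(τ) = exp(-ξ log(1 + e^τ)^{1/α}) / (1 + e^{-τ})`, with principal logarithm
and principal power. -/
def g (α ξ : ℝ) (τ : ℂ) : ℂ :=
  Complex.exp (-(Complex.log (1 + Complex.exp τ) ^ ((1 / α : ℝ) : ℂ)) * (ξ : ℂ)) /
    (1 + Complex.exp (-τ))

/-- The function `|f|` is integrable on both boundary lines `Im z = d` and `Im z = -d` of the
strip `D_d`, that is, the boundary norm below is finite. -/
def StripBoundaryIntegrable (d : ℝ) (f : ℂ → ℂ) : Prop :=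
  MeasureTheory.Integrable (fun t : ℝ => f ((t : ℂ) + (d : ℂ) * Complex.I)) ∧
    MeasureTheory.Integrable (fun t : ℝ => f ((t : ℂ) - (d : ℂ) * Complex.I))

/-- `‖f‖_{D_d} = ∫_{∂D_d} |f(z)| |dz|` for the strip `D_d = {z : |Im z| < d}`. -/
def stripNorm (d : ℝ) (f : ℂ → ℂ) : ℝ :=
  (∫ t : ℝ, ‖f ((t : ℂ) + (d : ℂ) * Complex.I)‖) +
    ∫ t : ℝ, ‖f ((t : ℂ) - (d : ℂ) * Complex.I)‖

/-- The truncated sinc quadrature `E_{m,n}(f,h) = h ∑_{j=-m}^{n} f(jh)`. -/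
def truncSinc (m n : ℕ) (f : ℂ → ℂ) (h : ℝ) : ℂ :=
  (h : ℂ) * ∑ j ∈ Finset.Icc (-(m : ℤ)) (n : ℤ), f ((j : ℂ) * (h : ℂ))

/-- The step `h = 2πd / log(1/ε)`. -/
def step (d ε : ℝ) : ℝ := 2 * Real.pi * d / Real.log ε⁻¹

/-- `β = cos(2d/α)`. -/
def beta (α d : ℝ) : ℝ := Real.cos (2 * d / α)

/-- `N_- = 2πd / h²`, rounded up to an integer. -/
def Nminus (d ε : ℝ) : ℕ := ⌈2 * Real.pi * d / step d ε ^ 2⌉₊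

/-- `N_+ = (2πd h^{-(α+1)/α} / β)^α`, rounded up to an integer. -/
def Nplus (α d ε : ℝ) : ℕ :=
  ⌈(2 * Real.pi * d * step d ε ^ (-((α + 1) / α)) / beta α d) ^ α⌉₊

/-- The number `N = N_- + N_+ + 1` of terms. -/
def numTerms (α d ε : ℝ) : ℕ := Nminus d ε + Nplus α d ε + 1

/-- The approximant of `ξ^{-α} = (1/Γ(α+1)) ∫ g(τ) dτ`: the truncated sinc quadrature of the
normalized integrand `g / Γ(α+1)`. -/
def approx (α d ε ξ : ℝ) : ℂ :=
  truncSinc (Nminus d ε) (Nplus α d ε) (fun τ => g α ξ τ / (Real.Gamma (α + 1) : ℂ)) (step d ε)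

/-- The approximation error at `ξ`. -/
def err (α d ε ξ : ℝ) : ℝ := ‖((ξ ^ (-α) : ℝ) : ℂ) - approx α d ε ξ‖

end

end SincExpSum

/-! ### Trapezoidal rule for functions holomorphic on a strip -/

namespace SincExpSum

open MeasureTheory Filter Topology Complex Asymptotics

/-! Discretization. `g` is holomorphic and dominated on the closed strip of half width `d`, so
Poisson summation writes the error of the infinite trapezoidal rule as a sum of Fourier integrals at
the frequencies `2πn/h`, `n ≠ 0`. Moving each contour to the boundary line on which the oscillating
factor is small gains `exp (-2πd|n|/h)`, which is `ε ^ |n|` for the chosen step; the geometric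
series gives `‖g‖ ε / (1 - ε)` (`norm_integral_sub_trapezoidal_le`).

Domination. The crucial point is that `log (1 + e^(t+iy))` has argument at most `|y|` in modulus
(`abs_arg_log_one_add_exp_le`). Its power `1/α` then has argument at most `d/α ≤ π/8`, so the
exponential in `g` really decays (`norm_g_le`). The resulting majorant is the derivative of
`softplus` times a function of `softplus`; substitution integrates it to a Gamma value and bounds
the strip norm uniformly in `ξ ≥ 1` (`stripNorm_g_le`).

Truncation. The left tail is below a geometric series in `e^(jh)`. The right tail is below one as
well, because the convex function `x ^ (1/α)` lies above its tangent at the cut-off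
(`abs_tsum_majorant_sub_sum_le`). The cut-offs make both leading factors at most `ε`.

Counting. With `L = log (1/ε)`, the two ceilings give `2πdN = L² + O(L^(1+α))`, and taking square
roots gives the accuracy in terms of `N`. -/

theorem integrable_horizontal_line {f : ℂ → ℂ} {F : ℝ → ℝ} {d y : ℝ}
    (hf : ∀ z : ℂ, |z.im| ≤ d → DifferentiableAt ℂ f z)
    (hbd : ∀ t s : ℝ, |s| ≤ d → ‖f (t + s * I)‖ ≤ F t)
    (hF : Integrable F) (hy : |y| ≤ d) : Integrable fun t : ℝ => f (t + y * I) := by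
  refine hF.mono' (Continuous.aestronglyMeasurable ?_) (Eventually.of_forall fun t => hbd t y hy)
  refine continuous_iff_continuousAt.2 fun t => ?_
  have h1 : ContinuousAt f (t + y * I) := (hf _ (by simpa using hy)).continuousAt
  exact ContinuousAt.comp (f := fun t : ℝ => (t : ℂ) + y * I) h1 (by fun_prop)

/-- The integral of a function holomorphic on a closed strip and dominated there by an integrable
function of the real part that vanishes at infinity does not depend on the horizontal line. -/
theorem integral_horizontal_line_eq {f : ℂ → ℂ} {F : ℝ → ℝ} {d y : ℝ}
    (hf : ∀ z : ℂ, |z.im| ≤ d → DifferentiableAt ℂ f z)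
    (hbd : ∀ t s : ℝ, |s| ≤ d → ‖f (t + s * I)‖ ≤ F t)
    (hF : Integrable F) (hF0 : Tendsto F (cocompact ℝ) (𝓝 0)) (hy : |y| ≤ d) :
    ∫ t : ℝ, f (t + y * I) = ∫ t : ℝ, f t := by
  have hline : ∀ s : ℝ, |s| ≤ d → Integrable fun t : ℝ => f (t + s * I) :=
    fun s hs => integrable_horizontal_line hf hbd hF hs
  have hd0 : 0 ≤ d := (abs_nonneg _).trans hy
  have hseg : ∀ s ∈ Set.uIcc 0 y, |s| ≤ d := fun s hs => by
    have := Set.abs_sub_left_of_mem_uIcc hs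
    simp only [sub_zero] at this
    exact this.trans hy
  -- Cauchy's theorem on the rectangle with vertices `±T` and `±T + iy`. The vertical sides are at
  -- most `F (±T) * |y|`, which is why `F` has to vanish at infinity.
  have hrect : ∀ T : ℝ, (∫ x : ℝ in -T..T, f x) - (∫ x : ℝ in -T..T, f (x + y * I)) =
      I • (∫ s : ℝ in 0..y, f ((-T : ℝ) + s * I)) - I • (∫ s : ℝ in 0..y, f (T + s * I)) := by
    intro T
    have h := integral_boundary_rect_eq_zero_of_differentiableOn f (-T : ℝ) (T + y * I) (by
      intro z hz
      refine (hf z (hseg _ ?_)).differentiableWithinAt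
      simpa [mem_reProdIm] using hz.2)
    simp at h
    simp only [smul_eq_mul]
    push_cast
    linear_combination h
  have hvert : ∀ T : ℝ, ‖∫ s : ℝ in 0..y, f (T + s * I)‖ ≤ F T * |y| := by
    intro T
    have := intervalIntegral.norm_integral_le_of_norm_le_const (a := 0) (b := y)
      (f := fun s : ℝ => f (T + s * I)) (C := F T) fun s hs =>
        hbd T s (hseg s (Set.uIoc_subset_uIcc hs))
    simpa using this
  have hFtop : Tendsto F atTop (𝓝 0) := hF0.mono_left atTop_le_cocompact
  have hFbot : Tendsto (fun T => F (-T)) atTop (𝓝 0) :=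
    (hF0.mono_left atBot_le_cocompact).comp tendsto_neg_atTop_atBot
  have hv1 : Tendsto (fun T : ℝ => ∫ s : ℝ in 0..y, f (T + s * I)) atTop (𝓝 0) :=
    squeeze_zero_norm hvert (by simpa using hFtop.mul_const |y|)
  have hv2 : Tendsto (fun T : ℝ => ∫ s : ℝ in 0..y, f ((-T : ℝ) + s * I)) atTop (𝓝 0) :=
    squeeze_zero_norm (fun T => hvert (-T)) (by simpa using hFbot.mul_const |y|)
  have h0 : Integrable fun t : ℝ => f t := by simpa using hline 0 (by simpa using hd0)
  have hlim := (intervalIntegral_tendsto_integral h0 tendsto_neg_atTop_atBot tendsto_id).sub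
    (intervalIntegral_tendsto_integral (hline y hy) tendsto_neg_atTop_atBot tendsto_id)
  have hlim0 := (hv2.const_smul I).sub (hv1.const_smul I)
  have := tendsto_nhds_unique hlim (hlim0.congr fun T => (hrect T).symm)
  simp only [smul_zero, sub_zero] at this
  exact (sub_eq_zero.1 this).symm

/-- Shifting the line of integration bounds the Fourier integral. -/
theorem norm_fourier_integral_le {f : ℂ → ℂ} {F : ℝ → ℝ} {d y : ℝ}
    (hf : ∀ z : ℂ, |z.im| ≤ d → DifferentiableAt ℂ f z)
    (hbd : ∀ t s : ℝ, |s| ≤ d → ‖f (t + s * I)‖ ≤ F t)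
    (hF : Integrable F) (hF0 : Tendsto F (cocompact ℝ) (𝓝 0)) (hy : |y| ≤ d) (ω : ℝ) :
    ‖∫ t : ℝ, exp (-(ω * t * I)) * f t‖ ≤
      Real.exp (ω * y) * ∫ t : ℝ, ‖f (t + y * I)‖ := by
  have hnorm : ∀ t s : ℝ, ‖exp (-(ω * (t + s * I) * I))‖ = Real.exp (ω * s) := by
    intro t s
    rw [norm_exp]
    congr 1
    simp
  have key := integral_horizontal_line_eq (f := fun z => exp (-(ω * z * I)) * f z)
    (F := fun t => Real.exp (|ω| * d) * F t) (d := d) (y := y)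
    (fun z hz => by
      have := hf z hz
      fun_prop)
    (fun t s hs => by
      simp only [norm_mul]
      rw [hnorm]
      have : ω * s ≤ |ω| * d :=
        (le_abs_self _).trans (by rw [abs_mul]; exact mul_le_mul_of_nonneg_left hs (abs_nonneg _))
      exact mul_le_mul (Real.exp_le_exp.2 this) (hbd t s hs) (norm_nonneg _) (Real.exp_pos _).le)
    (hF.const_mul _) (by simpa using hF0.const_mul (Real.exp (|ω| * d))) hy
  rw [← key]
  refine (norm_integral_le_integral_norm _).trans (le_of_eq ?_)
  simp_rw [norm_mul, hnorm]
  rw [integral_const_mul]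

/-- Sums the bounds on the nonzero frequencies. Positive and negative `n` carry different constants
because each sign uses only one boundary line; this yields `a + b`, the strip norm, without a factor
2. -/
theorem hasSum_int_geometric {q a b : ℝ} (hq0 : 0 ≤ q) (hq1 : q < 1) :
    HasSum (fun n : ℤ => if n = 0 then 0 else if 0 < n then b * q ^ n.natAbs
      else a * q ^ n.natAbs) ((a + b) * (q / (1 - q))) := by
  have hg := hasSum_geometric_of_lt_one hq0 hq1
  have h := HasSum.of_nat_of_neg_add_one (f := fun n : ℤ => if n = 0 then 0 else if 0 < n then
      b * q ^ n.natAbs else a * q ^ n.natAbs) (m := b * (q / (1 - q)))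
      (m' := a * (q / (1 - q))) ?_ ?_
  · rw [show (a + b) * (q / (1 - q)) = b * (q / (1 - q)) + a * (q / (1 - q)) by ring]
    exact h
  · refine (hasSum_nat_add_iff' 1).1 ?_
    rw [show b * (q / (1 - q)) - _ = b * q * (1 - q)⁻¹ by simp; ring]
    refine (congrArg (fun f : ℕ → ℝ => HasSum f _) (funext fun n => ?_)).mpr (hg.mul_left (b * q))
    have h1 : ((n : ℤ) + 1).natAbs = n + 1 := by omega
    have h2 : (n : ℤ) + 1 ≠ 0 := by omega
    have h3 : (0 : ℤ) < n + 1 := by omega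
    simp only [Nat.cast_add, Nat.cast_one, h2, h3, h1, if_true, if_false]
    ring
  · rw [show a * (q / (1 - q)) = a * q * (1 - q)⁻¹ by ring]
    refine (congrArg (fun f : ℕ → ℝ => HasSum f _) (funext fun n => ?_)).mpr (hg.mul_left (a * q))
    have h1 : (-((n : ℤ) + 1)).natAbs = n + 1 := by omega
    have h2 : -((n : ℤ) + 1) ≠ 0 := by omega
    have h3 : ¬ (0 : ℤ) < -(n + 1) := by omega
    simp only [h2, h3, h1, if_false]
    ring

/-- Sinc quadrature: for a function holomorphic on the closed strip of half width `d`, the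
trapezoidal rule with step `h` on the whole line has an error of at most
`‖f‖ * q / (1 - q)`, where `q = exp (-2πd/h)`. -/
theorem norm_integral_sub_trapezoidal_le {f : ℂ → ℂ} {F : ℝ → ℝ} {d h q : ℝ}
    (hd : 0 < d) (hh : 0 < h) (hq : q = Real.exp (-(2 * Real.pi * d / h)))
    (hf : ∀ z : ℂ, |z.im| ≤ d → DifferentiableAt ℂ f z)
    (hbd : ∀ t s : ℝ, |s| ≤ d → ‖f (t + s * I)‖ ≤ F t)
    (hF : Integrable F) (hFO : F =O[cocompact ℝ] fun t => |t| ^ (-2 : ℝ)) :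
    ‖(∫ t : ℝ, f t) - h * ∑' j : ℤ, f (j * h)‖ ≤ stripNorm d f * (q / (1 - q)) := by
  have hpi := Real.pi_pos
  have hq0 : 0 < q := hq ▸ Real.exp_pos _
  have hq1 : q < 1 := by
    rw [hq, Real.exp_lt_one_iff]
    have : 0 < 2 * Real.pi * d / h := by positivity
    linarith
  have hF0 : Tendsto F (cocompact ℝ) (𝓝 0) := by
    refine hFO.trans_tendsto ?_
    have h1 : Tendsto (fun t : ℝ => |t|) (cocompact ℝ) atTop := tendsto_norm_cocompact_atTop
    exact (tendsto_rpow_neg_atTop (by norm_num : (0 : ℝ) < 2)).comp h1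
  set φ : ℝ → ℂ := fun t => f (t * h) with hφ
  have hfc : Continuous fun t : ℝ => f t := by
    refine continuous_iff_continuousAt.2 fun t => ?_
    have h1 : ContinuousAt f (t : ℂ) := (hf _ (by simpa using hd.le)).continuousAt
    exact ContinuousAt.comp (f := fun t : ℝ => (t : ℂ)) h1 (by fun_prop)
  have hφc : Continuous φ := by
    have : φ = (fun t : ℝ => f t) ∘ fun t : ℝ => t * h := by
      ext t; simp [hφ]
    rw [this]; exact hfc.comp (by fun_prop)
  have hφO : φ =O[cocompact ℝ] fun t => |t| ^ (-2 : ℝ) := by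
    have hmul : Tendsto (fun t : ℝ => t * h) (cocompact ℝ) (cocompact ℝ) :=
      (Homeomorph.mulRight₀ h hh.ne').isClosedEmbedding.tendsto_cocompact
    have h1 : φ =O[cocompact ℝ] fun t => F (t * h) := by
      refine IsBigO.of_bound 1 (Eventually.of_forall fun t => ?_)
      have := hbd (t * h) 0 (by simpa using hd.le)
      simp only [ofReal_zero, zero_mul, add_zero, ofReal_mul] at this
      rw [one_mul]
      exact this.trans (Real.le_norm_self _)
    refine (h1.trans (hFO.comp_tendsto hmul)).trans ?_
    refine IsBigO.of_bound (h ^ (-2 : ℝ)) (Eventually.of_forall fun t => ?_)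
    simp only [Function.comp]
    rw [abs_mul, abs_of_pos hh, Real.mul_rpow (abs_nonneg _) hh.le, norm_mul, mul_comm]
    rw [Real.norm_of_nonneg (Real.rpow_nonneg hh.le _)]
  -- Rescaling by `h` turns the integer frequency `n` of `φ` into the frequency `2πn/h` of `f`.
  have hfour : ∀ n : ℤ, (h : ℂ) * FourierTransform.fourier φ n =
      ∫ t : ℝ, exp (-((2 * Real.pi * n / h : ℝ) * t * I)) * f t := by
    intro n
    rw [Real.fourier_real_eq_integral_exp_smul]
    have := Measure.integral_comp_mul_right
      (fun t : ℝ => exp (-((2 * Real.pi * n / h : ℝ) * t * I)) * f t) h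
    rw [abs_of_pos (inv_pos.2 hh)] at this
    have h2 : (∫ v : ℝ, exp ((-2 * Real.pi * v * n : ℝ) * I) • φ v) =
        ∫ x : ℝ, exp (-((2 * Real.pi * n / h : ℝ) * (x * h : ℝ) * I)) * f (x * h : ℝ) := by
      refine integral_congr_ae (Eventually.of_forall fun v => ?_)
      simp only [hφ, smul_eq_mul]
      have : (h : ℂ) ≠ 0 := ofReal_ne_zero.2 hh.ne'
      push_cast
      congr 2
      field_simp
    rw [h2, this, real_smul, ← mul_assoc]
    rw [← ofReal_mul, mul_inv_cancel₀ hh.ne', ofReal_one, one_mul]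
  set a := ∫ t : ℝ, ‖f (t + d * I)‖ with ha
  set b := ∫ t : ℝ, ‖f (t - d * I)‖ with hb
  have hbound : ∀ n : ℤ, n ≠ 0 → ‖(h : ℂ) * FourierTransform.fourier φ n‖ ≤
      if n = 0 then 0 else if 0 < n then b * q ^ n.natAbs else a * q ^ n.natAbs := by
    intro n hn
    rw [hfour, if_neg hn]
    -- The contour goes down for `n > 0` and up for `n < 0`, so that the factor `exp (ω * y)` is `q
    -- ^ |n|` in both cases.
    split_ifs with hpos
    · have := norm_fourier_integral_le hf hbd hF hF0 (y := -d) (by rw [abs_neg, abs_of_pos hd])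
        (2 * Real.pi * n / h)
      refine this.trans (le_of_eq ?_)
      rw [hb, mul_comm]
      congr 1
      · congr 1; ext t; congr 2; push_cast; ring
      · rw [hq, ← Real.exp_nat_mul, Nat.cast_natAbs, abs_of_pos hpos]
        congr 1; ring
    · have hneg : n < 0 := by omega
      have := norm_fourier_integral_le hf hbd hF hF0 (y := d) (by rw [abs_of_pos hd])
        (2 * Real.pi * n / h)
      refine this.trans (le_of_eq ?_)
      rw [ha, mul_comm]
      congr 1
      rw [hq, ← Real.exp_nat_mul, Nat.cast_natAbs, abs_of_neg hneg]
      push_cast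
      congr 1; ring
  have hgeo := hasSum_int_geometric (a := a) (b := b) hq0.le hq1
  -- The zero frequency is the integral itself and is masked. The bound on the others provides both
  -- the summability needed for Poisson summation and the final estimate.
  have hupd : ∀ n : ℤ, ‖if n = 0 then 0 else (h : ℂ) * FourierTransform.fourier φ n‖ ≤
      if n = 0 then 0 else if 0 < n then b * q ^ n.natAbs else a * q ^ n.natAbs := by
    intro n
    by_cases hn : n = 0
    · simp [hn]
    · rw [if_neg hn]; exact hbound n hn
  have hsum' : Summable fun n : ℤ => if n = 0 then 0 else (h : ℂ) * FourierTransform.fourier φ n :=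
    Summable.of_norm_bounded hgeo.summable hupd
  have hsumh : Summable fun n : ℤ => (h : ℂ) * FourierTransform.fourier φ n := by
    refine (summable_congr_cofinite ?_).1 hsum'
    filter_upwards [(Set.finite_singleton (0 : ℤ)).compl_mem_cofinite] with n hn
    exact if_neg hn
  have hsum : Summable fun n : ℤ => FourierTransform.fourier φ n :=
    (summable_mul_left_iff (ofReal_ne_zero.2 hh.ne')).1 hsumh
  have hpoisson := Real.tsum_eq_tsum_fourier_of_rpow_decay_of_summable hφc one_lt_two hφO hsum 0
  have hpoisson' : (h : ℂ) * ∑' j : ℤ, f (j * h) =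
      ∑' n : ℤ, (h : ℂ) * FourierTransform.fourier φ n := by
    rw [tsum_mul_left]
    congr 1
    simpa [hφ] using hpoisson
  have hzero : (h : ℂ) * FourierTransform.fourier φ (0 : ℤ) = ∫ t : ℝ, f t := by
    rw [hfour]; simp
  rw [hpoisson', hsumh.tsum_eq_add_tsum_ite 0, hzero, sub_add_cancel_left, norm_neg]
  exact tsum_of_norm_bounded hgeo hupd

end SincExpSum

/-! ### The real majorant and its integral -/

namespace SincExpSum

open MeasureTheory Filter Topology Complex Asymptotics

/-- The function `log (1 + e^t)`. -/
noncomputable def softplus (t : ℝ) : ℝ := Real.log (1 + Real.exp t)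

/-- The derivative `1 / (1 + e^{-t})` of `softplus` times `exp (-c (softplus t)^{1/α})`. -/
noncomputable def majorant (α c t : ℝ) : ℝ :=
  Real.sigmoid t * Real.exp (-c * softplus t ^ (1 / α))

theorem softplus_pos (t : ℝ) : 0 < softplus t :=
  Real.log_pos (by linarith [Real.exp_pos t])

theorem lt_softplus (t : ℝ) : t < softplus t := by
  rw [softplus, Real.lt_log_iff_exp_lt (by positivity)]
  linarith

theorem hasDerivAt_softplus (t : ℝ) : HasDerivAt softplus (Real.sigmoid t) t := by
  have h := ((Real.hasDerivAt_exp t).const_add 1).log (by positivity)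
  convert! h using 1
  rw [Real.sigmoid_def, Real.exp_neg]
  field_simp
  ring

theorem softplus_injective : Function.Injective softplus := by
  intro s t h
  have hpos : ∀ r : ℝ, 1 + Real.exp r ∈ Set.Ioi 0 := fun r => by
    have := Real.exp_pos r
    simp only [Set.mem_Ioi]
    linarith
  have := Real.log_injOn_pos (hpos s) (hpos t) h
  exact Real.exp_injective (by linarith)

theorem image_softplus : softplus '' Set.univ = Set.Ioi 0 := by
  rw [Set.image_univ]
  refine Set.Subset.antisymm (Set.range_subset_iff.2 softplus_pos) fun x hx => ?_
  have hx : 0 < x := hx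
  have h1 : 0 < Real.exp x - 1 := by
    have := Real.add_one_lt_exp hx.ne'
    linarith
  exact ⟨Real.log (Real.exp x - 1), by simp [softplus, Real.exp_log h1]⟩

theorem integrable_majorant {α c : ℝ} (hα : 0 < α) (hc : 0 < c) : Integrable (majorant α c) := by
  have h := (integrableOn_image_iff_integrableOn_abs_deriv_smul MeasurableSet.univ
    (fun t _ => (hasDerivAt_softplus t).hasDerivWithinAt) softplus_injective.injOn
    (fun x => Real.exp (-c * x ^ (1 / α)))).1 (by
      rw [image_softplus]
      simpa using integrableOn_rpow_mul_exp_neg_mul_rpow (s := 0) (by norm_num)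
        (show 0 < 1 / α by positivity) hc)
  rw [integrableOn_univ] at h
  refine h.congr (Eventually.of_forall fun t => ?_)
  simp [majorant, abs_of_pos (Real.sigmoid_pos t)]

/-- The substitution `x = softplus t` maps the line onto `(0, ∞)` and leaves the integral of `exp
(-c x^(1/α))`. For `c = ξ` this is the integral representation of `ξ ^ (-α)`. -/
theorem integral_majorant {α c : ℝ} (hα : 0 < α) (hc : 0 < c) :
    ∫ t, majorant α c t = c ^ (-α) * Real.Gamma (α + 1) := by
  have h := integral_image_eq_integral_abs_deriv_smul MeasurableSet.univ
    (fun t _ => (hasDerivAt_softplus t).hasDerivWithinAt) softplus_injective.injOn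
    (fun x => Real.exp (-c * x ^ (1 / α)))
  rw [image_softplus, integral_exp_neg_mul_rpow (by positivity) hc, setIntegral_univ] at h
  simp only [one_div, inv_inv] at h
  rw [show -1 / α⁻¹ = -α by field_simp] at h
  rw [h]
  refine integral_congr_ae (Eventually.of_forall fun t => ?_)
  simp [majorant, abs_of_pos (Real.sigmoid_pos t)]

theorem majorant_pos (α c t : ℝ) : 0 < majorant α c t :=
  mul_pos (Real.sigmoid_pos t) (Real.exp_pos _)

theorem sigmoid_le_exp (t : ℝ) : Real.sigmoid t ≤ Real.exp t := by
  rw [Real.sigmoid_def, ← neg_neg t, Real.exp_neg (-t), neg_neg]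
  exact inv_anti₀ (Real.exp_pos _) (by linarith)

theorem majorant_le_exp {α c : ℝ} (hc : 0 ≤ c) (t : ℝ) : majorant α c t ≤ Real.exp t := by
  have h1 : Real.exp (-c * softplus t ^ (1 / α)) ≤ 1 := by
    rw [Real.exp_le_one_iff]
    have := mul_nonneg hc (Real.rpow_nonneg (softplus_pos t).le (1 / α))
    linarith
  calc majorant α c t ≤ Real.sigmoid t * 1 :=
        mul_le_mul_of_nonneg_left h1 (Real.sigmoid_pos t).le
    _ ≤ _ := by simpa using sigmoid_le_exp t

theorem majorant_le_exp_neg {α c t : ℝ} (hα : 0 < α) (hc : 0 ≤ c) (ht : 0 ≤ t) :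
    majorant α c t ≤ Real.exp (-c * t ^ (1 / α)) := by
  have h1 : Real.exp (-c * softplus t ^ (1 / α)) ≤ Real.exp (-c * t ^ (1 / α)) := by
    have := Real.rpow_le_rpow ht (lt_softplus t).le (show 0 ≤ 1 / α by positivity)
    have := mul_le_mul_of_nonneg_left this hc
    exact Real.exp_le_exp.2 (by linarith)
  calc majorant α c t ≤ 1 * Real.exp (-c * t ^ (1 / α)) :=
        mul_le_mul (Real.sigmoid_le_one t) h1 (Real.exp_pos _).le zero_le_one
    _ = _ := one_mul _

/-- Decay needed for Poisson summation. On the left the majorant is below `e^t`; on the right it is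
below `e^(-ct)` for `t ≥ 1`, since `1/α ≥ 1`. -/
theorem majorant_isBigO {α c : ℝ} (hα0 : 0 < α) (hα1 : α ≤ 1) (hc : 0 < c) :
    majorant α c =O[cocompact ℝ] fun t => |t| ^ (-2 : ℝ) := by
  rw [cocompact_eq_atBot_atTop, isBigO_sup]
  constructor
  · have h1 : (fun t : ℝ => Real.exp (-1 * (-t))) =O[atBot] fun t : ℝ => (-t) ^ (-2 : ℝ) :=
      ((isLittleO_exp_neg_mul_rpow_atTop one_pos (-2)).comp_tendsto
        tendsto_neg_atBot_atTop).isBigO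
    refine (IsBigO.of_bound 1 (Eventually.of_forall fun t => ?_)).trans
      (h1.congr' EventuallyEq.rfl ?_)
    · rw [Real.norm_of_nonneg (majorant_pos _ _ _).le, Real.norm_of_nonneg (Real.exp_pos _).le]
      simpa using majorant_le_exp hc.le t
    · filter_upwards [eventually_le_atBot 0] with t ht
      rw [abs_of_nonpos ht]
  · have h1 := (isLittleO_exp_neg_mul_rpow_atTop hc (-2)).isBigO
    refine IsBigO.trans (IsBigO.of_bound 1 ?_) (h1.congr' EventuallyEq.rfl ?_)
    · filter_upwards [eventually_ge_atTop 1] with t ht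
      rw [Real.norm_of_nonneg (majorant_pos _ _ _).le, Real.norm_of_nonneg (Real.exp_pos _).le,
        one_mul]
      refine (majorant_le_exp_neg hα0 hc.le (by linarith)).trans (Real.exp_le_exp.2 ?_)
      have h2 : t ≤ t ^ (1 / α) := Real.self_le_rpow_of_one_le ht (by rw [le_div_iff₀ hα0]; linarith)
      have := mul_le_mul_of_nonneg_left h2 hc.le
      linarith
    · filter_upwards [eventually_ge_atTop 0] with t ht
      rw [abs_of_nonneg ht]

/-! ### Holomorphy and size of `g` on the strip -/

theorem cos_mul_le_norm_one_add_exp {t y : ℝ} (hy : 0 ≤ Real.cos y) :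
    Real.cos y * (1 + Real.exp t) ≤ ‖1 + exp (t + y * I)‖ := by
  have hs := Real.exp_pos t
  have hc := Real.cos_le_one y
  rw [norm_def]
  refine Real.le_sqrt_of_sq_le ?_
  have hre : (1 + exp (t + y * I)).re = 1 + Real.exp t * Real.cos y := by simp [exp_re]
  have him : (1 + exp (t + y * I)).im = Real.exp t * Real.sin y := by simp [exp_im]
  rw [normSq_apply, hre, him]
  have hsc := Real.sin_sq_add_cos_sq y
  have h1 : 0 ≤ Real.exp t * (Real.cos y * (1 - Real.cos y)) :=
    mul_nonneg hs.le (mul_nonneg hy (by linarith))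
  have h2 : 0 ≤ (1 + Real.exp t ^ 2) * Real.sin y ^ 2 := by positivity
  nlinarith

theorem re_one_add_exp_pos {z : ℂ} (hz : 0 < Real.cos z.im) : 0 < (1 + exp z).re := by
  have := mul_pos (Real.exp_pos z.re) hz
  simp only [add_re, one_re, exp_re]
  linarith

/-- Bernoulli's inequality with exponent `cos y ≤ 1` gives `(1 + e^t)^(cos y) ≤ 1 + cos y * e^t`.
The right side is the real part of `1 + e^(t+iy)`, hence at most its modulus; take logarithms. -/
theorem cos_mul_softplus_le_re_log {t y : ℝ} (hy : 0 ≤ Real.cos y) :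
    Real.cos y * softplus t ≤ (log (1 + exp (t + y * I))).re := by
  have hs := Real.exp_pos t
  have h1 : (1 + Real.exp t) ^ Real.cos y ≤ 1 + Real.cos y * Real.exp t :=
    rpow_one_add_le_one_add_mul_self (by linarith) hy (Real.cos_le_one y)
  have h2 : 1 + Real.cos y * Real.exp t ≤ ‖1 + exp (t + y * I)‖ := by
    refine le_trans (le_of_eq ?_) (re_le_norm _)
    simp [exp_re, mul_comm]
  rw [log_re, softplus, ← Real.log_rpow (by positivity)]
  exact Real.log_le_log (Real.rpow_pos_of_pos (by positivity) _) (h1.trans h2)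

theorem im_log_mul_cos_le {q y : ℝ} (hq : 0 ≤ q) (hy0 : 0 ≤ y) (hy : y < Real.pi / 2) :
    (log (1 + q * exp (y * I))).im * Real.cos y ≤ (log (1 + q * exp (y * I))).re * Real.sin y := by
  have hcos : 0 < Real.cos y := Real.cos_pos_of_mem_Ioo ⟨by linarith, hy⟩
  have hsin : 0 ≤ Real.sin y := Real.sin_nonneg_of_nonneg_of_le_pi hy0 (by linarith)
  have hslit : ∀ s : ℝ, 0 ≤ s → (1 + s * exp (y * I)) ∈ slitPlane := by
    intro s hs
    refine Or.inl ?_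
    have := mul_nonneg hs hcos.le
    simp [exp_re]
    linarith
  -- The claim says that `log (1 + q e^(iy))`, rotated by `-y`, has nonpositive imaginary part. This
  -- rotated function vanishes at `s = 0` and has derivative `1 / (1 + s e^(iy))`, whose imaginary
  -- part is nonpositive.
  set ψ : ℝ → ℂ := fun s => exp (-(y * I)) * log (1 + s * exp (y * I)) with hψ
  have hder : ∀ s : ℝ, 0 ≤ s → HasDerivAt ψ ((1 + s * exp (y * I))⁻¹) s := by
    intro s hs
    have h1 : HasDerivAt (fun s : ℝ => 1 + (s : ℂ) * exp (y * I)) (exp (y * I)) s := by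
      simpa using ((hasDerivAt_id s).ofReal_comp.mul_const (exp (y * I))).const_add (1 : ℂ)
    have h2 := (h1.clog_real (hslit s hs)).const_mul (exp (-(y * I)))
    convert! h2 using 1
    rw [← mul_div_assoc, ← exp_add]
    simp
  have hanti : AntitoneOn (fun s => (ψ s).im) (Set.Ici 0) := by
    refine antitoneOn_of_hasDerivWithinAt_nonpos (f' := fun s : ℝ => ((1 + s * exp (y * I))⁻¹).im)
      (convex_Ici 0) ?_ ?_ ?_
    · intro s hs
      exact (continuous_im.continuousAt.comp (hder s hs).continuousAt).continuousWithinAt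
    · intro s hs
      rw [interior_Ici] at hs
      exact (imCLM.hasFDerivAt.comp_hasDerivAt s (hder s (le_of_lt hs))).hasDerivWithinAt
    · intro s hs
      rw [interior_Ici] at hs
      have : (1 + s * exp (y * I)).im = s * Real.sin y := by simp [exp_im]
      rw [inv_im, this]
      have : 0 ≤ s * Real.sin y := mul_nonneg (le_of_lt hs) hsin
      exact div_nonpos_of_nonpos_of_nonneg (by linarith) (normSq_nonneg _)
  have h := hanti (Set.self_mem_Ici) hq hq
  have hre : (exp (-(y * I))).re = Real.cos y := by simp [exp_re]
  have him : (exp (-(y * I))).im = -Real.sin y := by simp [exp_im]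
  simp only [hψ, mul_im, hre, him] at h
  simp only [ofReal_zero, zero_mul, add_zero, log_one, zero_im, zero_re, mul_zero] at h
  linarith

/-- For `y ≥ 0`, `im_log_mul_cos_le` reads `‖L‖ sin (arg L - y) ≤ 0`, which excludes `arg L > y`.
Negative `y` follows by conjugation, all values being off the branch cut. -/
theorem abs_arg_log_one_add_exp_le {t y : ℝ} (hy : |y| < Real.pi / 2) :
    |arg (log (1 + exp (t + y * I)))| ≤ |y| := by
  have key : ∀ y : ℝ, 0 ≤ y → y < Real.pi / 2 → |arg (log (1 + exp (t + y * I)))| ≤ y := by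
    intro y hy0 hy
    have hcos : 0 < Real.cos y := Real.cos_pos_of_mem_Ioo ⟨by linarith, hy⟩
    have hsin : 0 ≤ Real.sin y := Real.sin_nonneg_of_nonneg_of_le_pi hy0 (by linarith)
    have hLre : 0 < (log (1 + exp (t + y * I))).re :=
      (mul_pos hcos (softplus_pos t)).trans_le (cos_mul_softplus_le_re_log hcos.le)
    have hLim : 0 ≤ (log (1 + exp (t + y * I))).im := by
      rw [log_im, arg_nonneg_iff]
      simpa [exp_im] using mul_nonneg (Real.exp_pos t).le hsin
    have h := im_log_mul_cos_le (Real.exp_pos t).le hy0 hy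
    rw [ofReal_exp, ← exp_add] at h
    set L := log (1 + exp (t + y * I)) with hL
    have hθ0 : 0 ≤ arg L := arg_nonneg_iff.2 hLim
    have hθ1 : arg L < Real.pi / 2 := (abs_lt.1 (abs_arg_lt_pi_div_two_iff.2 (Or.inl hLre))).2
    have hL0 : 0 < ‖L‖ := norm_pos_iff.2 fun h0 => by simp [h0] at hLre
    rw [abs_of_nonneg hθ0]
    by_contra! hlt
    have h3 : 0 < Real.sin (arg L - y) :=
      Real.sin_pos_of_pos_of_lt_pi (by linarith) (by linarith)
    rw [Real.sin_sub] at h3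
    rw [← norm_mul_cos_arg L, ← norm_mul_sin_arg L] at h
    nlinarith [mul_pos hL0 h3]
  rcases le_total 0 y with h0 | h0
  · rw [abs_of_nonneg h0] at hy ⊢
    exact key y h0 hy
  · rw [abs_of_nonpos h0] at hy ⊢
    have hk := key (-y) (by linarith) hy
    have hcos : 0 < Real.cos (-y) := Real.cos_pos_of_mem_Ioo ⟨by linarith, hy⟩
    have e : 1 + exp (t + y * I) =
        (starRingEnd ℂ) (1 + exp (t + (-y : ℝ) * I)) := by
      rw [map_add, map_one, ← exp_conj]
      simp
    have hre := re_one_add_exp_pos (z := t + (-y : ℝ) * I) (by simpa using hcos)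
    have hLre : 0 < (log (1 + exp (t + (-y : ℝ) * I))).re :=
      (mul_pos hcos (softplus_pos t)).trans_le (cos_mul_softplus_le_re_log hcos.le)
    have h1 : ∀ z : ℂ, 0 < z.re → arg z ≠ Real.pi := fun z hz h =>
      absurd (arg_eq_pi_iff.1 h).1 (by linarith)
    rw [e, log_conj _ (h1 _ hre), arg_conj, if_neg (h1 _ hLre), abs_neg]
    exact hk

section

variable {α d : ℝ}

theorem cos_pos_of_abs_le {y : ℝ} (hd : d < Real.pi / 2) (hy : |y| ≤ d) : 0 < Real.cos y := by
  have := abs_le.1 hy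
  exact Real.cos_pos_of_mem_Ioo ⟨by linarith, by linarith⟩

theorem cos_le_cos_of_abs_le {x y : ℝ} (hy : y ≤ Real.pi) (hx : |x| ≤ y) :
    Real.cos y ≤ Real.cos x := by
  rw [← Real.cos_abs x]
  exact Real.cos_le_cos_of_nonneg_of_le_pi (abs_nonneg x) hy hx

theorem differentiableAt_g (ξ : ℝ) (hd : d < Real.pi / 2) {z : ℂ} (hz : |z.im| ≤ d) :
    DifferentiableAt ℂ (g α ξ) z := by
  have hcos := cos_pos_of_abs_le hd hz
  have h1 : 1 + exp z ∈ slitPlane := Or.inl (re_one_add_exp_pos hcos)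
  have h2 : log (1 + exp z) ∈ slitPlane := by
    refine Or.inl ?_
    have := (mul_pos hcos (softplus_pos z.re)).trans_le (cos_mul_softplus_le_re_log hcos.le)
    rwa [re_add_im] at this
  have h3 : 1 + exp (-z) ≠ 0 := by
    have := re_one_add_exp_pos (z := -z) (by simpa using hcos)
    exact fun h => by simp [h] at this
  unfold g
  refine DifferentiableAt.div ?_ (by fun_prop) h3
  refine DifferentiableAt.cexp (DifferentiableAt.mul_const (DifferentiableAt.neg ?_) _)
  refine DifferentiableAt.cpow ?_ (by fun_prop) h2
  exact DifferentiableAt.clog (by fun_prop) h1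

/-- The exponential rate of the majorant of `g` on the strip of half width `d`. -/
noncomputable def rate (α d : ℝ) : ℝ := Real.cos d ^ (1 / α) * Real.cos (d / α)

/-- The modulus of the logarithm contributes `cos d ^ (1/α)` to the rate and its argument
contributes `cos (d/α)`; the prefactor comes from the denominator `1 + e^(-z)`. -/
theorem norm_g_le {ξ : ℝ} (hα : 0 < α) (hξ : 0 ≤ ξ) (hd : d < Real.pi / 2)
    (hdα : d / α ≤ Real.pi / 2) {t y : ℝ} (hy : |y| ≤ d) :
    ‖g α ξ (t + y * I)‖ ≤ (Real.cos d)⁻¹ * majorant α (ξ * rate α d) t := by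
  have hcos := cos_pos_of_abs_le hd hy
  have hd0 : 0 ≤ d := (abs_nonneg y).trans hy
  have hdα0 : 0 ≤ d / α := by positivity
  have hcosd : 0 < Real.cos d := Real.cos_pos_of_mem_Ioo ⟨by linarith, hd⟩
  have hcd : Real.cos d ≤ Real.cos y := cos_le_cos_of_abs_le (by linarith) hy
  have hcα : 0 ≤ Real.cos (d / α) := Real.cos_nonneg_of_mem_Icc ⟨by linarith, hdα⟩
  set L := log (1 + exp (t + y * I)) with hL
  have hLn : Real.cos d * softplus t ≤ ‖L‖ :=
    (mul_le_mul_of_nonneg_right hcd (softplus_pos t).le).trans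
      ((cos_mul_softplus_le_re_log hcos.le).trans (re_le_norm _))
  have harg : |arg L * (1 / α)| ≤ d / α := by
    rw [abs_mul, abs_of_pos (show 0 < 1 / α by positivity), mul_one_div]
    have := abs_arg_log_one_add_exp_le (t := t) (y := y) (by linarith)
    exact div_le_div_of_nonneg_right (this.trans hy) hα.le
  have hre : rate α d * softplus t ^ (1 / α) ≤ (L ^ ((1 / α : ℝ) : ℂ)).re := by
    rw [cpow_ofReal_re, rate]
    have h1 := Real.rpow_le_rpow (mul_nonneg hcosd.le (softplus_pos t).le) hLn
      (show 0 ≤ 1 / α by positivity)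
    rw [Real.mul_rpow hcosd.le (softplus_pos t).le] at h1
    have h2 : Real.cos (d / α) ≤ Real.cos (arg L * (1 / α)) :=
      cos_le_cos_of_abs_le (by linarith [Real.pi_pos]) harg
    calc _ = (Real.cos d ^ (1 / α) * softplus t ^ (1 / α)) * Real.cos (d / α) := by ring
      _ ≤ _ := mul_le_mul h1 h2 hcα (Real.rpow_nonneg (norm_nonneg _) _)
  have hden : Real.cos d * (Real.sigmoid t)⁻¹ ≤ ‖1 + exp (-(t + y * I))‖ := by
    have h := cos_mul_le_norm_one_add_exp (t := -t) (y := -y) (by simpa using hcos.le)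
    rw [Real.cos_neg] at h
    rw [Real.sigmoid_def, inv_inv]
    refine (mul_le_mul_of_nonneg_right hcd (by positivity)).trans (h.trans (le_of_eq ?_))
    congr 3
    push_cast
    ring
  have hpos : 0 < Real.cos d * (Real.sigmoid t)⁻¹ :=
    mul_pos hcosd (inv_pos.2 (Real.sigmoid_pos t))
  rw [g, norm_div, norm_exp, ← hL]
  have hnum : Real.exp (-(L ^ ((1 / α : ℝ) : ℂ)) * ξ).re ≤
      Real.exp (-(ξ * rate α d) * softplus t ^ (1 / α)) := by
    refine Real.exp_le_exp.2 ?_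
    rw [re_mul_ofReal, neg_re]
    nlinarith [mul_le_mul_of_nonneg_left hre hξ]
  calc _ ≤ Real.exp (-(ξ * rate α d) * softplus t ^ (1 / α)) / (Real.cos d * (Real.sigmoid t)⁻¹) :=
        div_le_div₀ (Real.exp_pos _).le hnum hpos hden
    _ = _ := by
        rw [majorant, div_eq_mul_inv, mul_inv, inv_inv]
        ring

theorem g_ofReal (α ξ t : ℝ) : g α ξ t = (majorant α ξ t : ℂ) := by
  have h1 : log (1 + exp t) = (softplus t : ℂ) := by
    rw [softplus, ofReal_log (by positivity)]
    push_cast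
    rfl
  rw [g, h1, ← ofReal_cpow (softplus_pos t).le, majorant, Real.sigmoid_def]
  push_cast
  rw [div_eq_mul_inv, mul_comm]
  congr 2
  ring

theorem rate_pos (hd0 : 0 < d) (hα : 0 < α) (hd : d < Real.pi / 2) (hdα : d / α < Real.pi / 2) :
    0 < rate α d := by
  have : 0 < d / α := by positivity
  exact mul_pos (Real.rpow_pos_of_pos (Real.cos_pos_of_mem_Ioo ⟨by linarith, hd⟩) _)
    (Real.cos_pos_of_mem_Ioo ⟨by linarith, hdα⟩)

/-- With `k = cos (π/8)`, the factor `1 / cos d` costs `1/k` and `rate ^ (-α)` costs at most `1/k²`.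
Each boundary line thus contributes at most `k⁻³ ≤ 1.27` times the Gamma value. -/
theorem stripNorm_g_le {ξ : ℝ} (hα0 : 0 < α) (hα1 : α < 1) (hd0 : 0 < d)
    (hd : d ≤ Real.pi * α / 8) (hξ : 1 ≤ ξ) :
    stripNorm d (g α ξ) ≤ 2.54 * Real.Gamma (α + 1) := by
  have hpi := Real.pi_pos
  have hd1 : d ≤ Real.pi / 8 := hd.trans (by nlinarith)
  have hdα : d / α ≤ Real.pi / 8 := by rw [div_le_iff₀ hα0]; linarith
  have hdα0 : 0 < d / α := by positivity
  have hr : 0 < rate α d := rate_pos hd0 hα0 (by linarith) (by linarith)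
  have hc : 0 < ξ * rate α d := by positivity
  have hline : ∀ y : ℝ, |y| ≤ d → ∫ t : ℝ, ‖g α ξ (t + y * I)‖ ≤
      (Real.cos d)⁻¹ * ((ξ * rate α d) ^ (-α) * Real.Gamma (α + 1)) := by
    intro y hy
    rw [← integral_majorant hα0 hc, ← integral_const_mul]
    refine integral_mono_of_nonneg (Eventually.of_forall fun t => norm_nonneg _)
      ((integrable_majorant hα0 hc).const_mul _) (Eventually.of_forall fun t => ?_)
    exact norm_g_le hα0 (by linarith) (by linarith) (by linarith) hy
  have h1 := hline d (by rw [abs_of_pos hd0])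
  have h2 := hline (-d) (by rw [abs_neg, abs_of_pos hd0])
  have e2 : ∀ t : ℝ, (t : ℂ) + (-d : ℝ) * I = t - d * I := fun t => by push_cast; ring
  simp_rw [e2] at h2
  have hΓ := Real.Gamma_pos_of_pos (show 0 < α + 1 by linarith)
  set k := Real.cos (Real.pi / 8) with hk
  have hk2 : k ^ 2 = (2 + √2) / 4 := by
    rw [hk, Real.cos_pi_div_eight, div_pow, Real.sq_sqrt (by positivity)]
    norm_num
  have hk0 : 0 < k := Real.cos_pos_of_mem_Ioo ⟨by linarith, by linarith⟩
  have hk1 : k ≤ 1 := Real.cos_le_one _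
  have hkd : k ≤ Real.cos d := Real.cos_le_cos_of_nonneg_of_le_pi hd0.le (by linarith) hd1
  have hkα : k ≤ Real.cos (d / α) :=
    Real.cos_le_cos_of_nonneg_of_le_pi hdα0.le (by linarith) hdα
  have hcd : 0 < Real.cos d := hk0.trans_le hkd
  have hcα : 0 < Real.cos (d / α) := hk0.trans_le hkα
  have hrα : k ^ 2 ≤ (ξ * rate α d) ^ α := by
    rw [rate, Real.mul_rpow (by linarith) (by positivity),
      Real.mul_rpow (by positivity) hcα.le, ← Real.rpow_mul hcd.le, one_div,
      inv_mul_cancel₀ hα0.ne', Real.rpow_one]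
    have h3 : k ≤ Real.cos (d / α) ^ α :=
      hkα.trans (Real.self_le_rpow_of_le_one hcα.le (Real.cos_le_one _) hα1.le)
    have h4 : 1 ≤ ξ ^ α := Real.one_le_rpow hξ hα0.le
    calc k ^ 2 = 1 * (k * k) := by ring
      _ ≤ _ := mul_le_mul h4 (mul_le_mul hkd h3 hk0.le hcd.le) (by positivity) (by positivity)
  have h3 : (Real.cos d)⁻¹ * (ξ * rate α d) ^ (-α) ≤ 1.27 := by
    rw [Real.rpow_neg hc.le, ← mul_inv]
    have h4 : k ^ 3 ≤ Real.cos d * (ξ * rate α d) ^ α := by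
      calc k ^ 3 = k * k ^ 2 := by ring
        _ ≤ _ := mul_le_mul hkd hrα (by positivity) hcd.le
    have hs : (1.4142 : ℝ) ≤ √2 := Real.le_sqrt_of_sq_le (by norm_num)
    have h5 : (0.8535 : ℝ) ≤ k ^ 2 := by rw [hk2]; linarith
    have h6 : (0.9238 : ℝ) ≤ k := by nlinarith
    have h7 : (1.27 : ℝ)⁻¹ ≤ k ^ 3 := by
      have : (0.9238 : ℝ) * 0.8535 ≤ k * k ^ 2 := by gcongr
      rw [show k ^ 3 = k * k ^ 2 by ring]
      refine le_trans (by norm_num) this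
    exact inv_le_of_inv_le₀ (by norm_num) (h7.trans h4)
  have h5 := mul_le_mul_of_nonneg_right h3 hΓ.le
  rw [stripNorm]
  linarith

theorem stripBoundaryIntegrable_g {ξ : ℝ} (hα0 : 0 < α) (hα1 : α < 1) (hd0 : 0 < d)
    (hd : d ≤ Real.pi * α / 8) (hξ : 1 ≤ ξ) : StripBoundaryIntegrable d (g α ξ) := by
  have hpi := Real.pi_pos
  have hd1 : d ≤ Real.pi / 8 := hd.trans (by nlinarith)
  have hdα : d / α ≤ Real.pi / 8 := by rw [div_le_iff₀ hα0]; linarith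
  have hr : 0 < rate α d := rate_pos hd0 hα0 (by linarith) (by linarith)
  have hc : 0 < ξ * rate α d := by positivity
  have hline : ∀ y : ℝ, |y| ≤ d → Integrable fun t : ℝ => g α ξ (t + y * I) := fun y hy =>
    integrable_horizontal_line (fun z hz => differentiableAt_g ξ (by linarith) hz)
      (fun t s hs => norm_g_le hα0 (by linarith) (by linarith) (by linarith) hs)
      ((integrable_majorant hα0 hc).const_mul _) hy
  refine ⟨hline d (by rw [abs_of_pos hd0]), ?_⟩
  have := hline (-d) (by rw [abs_neg, abs_of_pos hd0])
  refine this.congr (Eventually.of_forall fun t => ?_)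
  simp only [ofReal_neg, neg_mul, sub_eq_add_neg]

/-- Error of the untruncated sinc quadrature for `ξ ^ (-α) * Γ (α + 1) = ∫ g`. -/
theorem abs_sub_trapezoidal_majorant_le {ξ h q : ℝ} (hα0 : 0 < α) (hα1 : α < 1) (hd0 : 0 < d)
    (hd : d ≤ Real.pi * α / 8) (hξ : 1 ≤ ξ) (hh : 0 < h)
    (hq : q = Real.exp (-(2 * Real.pi * d / h))) :
    |ξ ^ (-α) * Real.Gamma (α + 1) - h * ∑' j : ℤ, majorant α ξ (j * h)| ≤
      stripNorm d (g α ξ) * (q / (1 - q)) := by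
  have hpi := Real.pi_pos
  have hd1 : d ≤ Real.pi / 8 := hd.trans (by nlinarith)
  have hdα : d / α ≤ Real.pi / 8 := by rw [div_le_iff₀ hα0]; linarith
  have hr : 0 < rate α d := rate_pos hd0 hα0 (by linarith) (by linarith)
  have hc : 0 < ξ * rate α d := by positivity
  have key := norm_integral_sub_trapezoidal_le hd0 hh hq
    (fun z hz => differentiableAt_g (α := α) ξ (by linarith) hz)
    (fun t s hs => norm_g_le hα0 (by linarith) (by linarith) (by linarith) hs)
    ((integrable_majorant hα0 hc).const_mul _) ((majorant_isBigO hα0 hα1.le hc).const_mul_left _)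
  have e1 : ∫ t : ℝ, g α ξ t = ((ξ ^ (-α) * Real.Gamma (α + 1) : ℝ) : ℂ) := by
    simp_rw [g_ofReal]
    rw [integral_complex_ofReal, integral_majorant hα0 (by linarith)]
  have e2 : ∑' j : ℤ, g α ξ (j * h) = ((∑' j : ℤ, majorant α ξ (j * h) : ℝ) : ℂ) := by
    rw [ofReal_tsum]
    refine tsum_congr fun j => ?_
    rw [← g_ofReal]
    push_cast
    rfl
  rw [e1, e2, ← ofReal_mul, ← ofReal_sub, norm_real, Real.norm_eq_abs] at key
  exact key

end

end SincExpSum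

/-! ### Truncation of the series and the exponential sum -/

namespace SincExpSum

open Complex

theorem sum_Icc_neg_eq_add (f : ℤ → ℝ) (m n : ℕ) :
    ∑ j ∈ Finset.Icc (-(m : ℤ)) n, f j =
      ∑ k ∈ Finset.range (n + 1), f k + ∑ k ∈ Finset.range m, f (-((k : ℤ) + 1)) := by
  induction m with
  | zero =>
    have : Finset.Icc (-((0 : ℕ) : ℤ)) n = (Finset.range (n + 1)).map Nat.castEmbedding := by
      ext j
      simp only [Finset.mem_Icc, Finset.mem_map, Finset.mem_range, Nat.castEmbedding_apply]
      constructor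
      · intro h
        exact ⟨j.toNat, by omega, by omega⟩
      · rintro ⟨k, hk, rfl⟩
        omega
    rw [this, Finset.sum_map]
    simp
  | succ m ih =>
    have : Finset.Icc (-((m + 1 : ℕ) : ℤ)) n =
        insert (-((m : ℤ) + 1)) (Finset.Icc (-(m : ℤ)) n) := by
      ext j
      simp only [Finset.mem_Icc, Finset.mem_insert]
      omega
    rw [this, Finset.sum_insert (by simp), ih, Finset.sum_range_succ _ m]
    ring

/-- The omitted indices are `n + 1, n + 2, …` and `-(m + 1), -(m + 2), …`; each tail is compared
with its own series. -/
theorem abs_tsum_int_sub_sum_Icc_le {f : ℤ → ℝ} {u v : ℕ → ℝ} {U V : ℝ} {m n : ℕ}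
    (hf : ∀ j, 0 ≤ f j) (hu : HasSum u U) (hv : HasSum v V)
    (hfu : ∀ k : ℕ, f ((k : ℤ) + (n + 1)) ≤ u k) (hfv : ∀ k : ℕ, f (-((k : ℤ) + m + 1)) ≤ v k) :
    |∑' j, f j - ∑ j ∈ Finset.Icc (-(m : ℤ)) n, f j| ≤ U + V := by
  have hs1 : Summable fun k : ℕ => f ((k + (n + 1) : ℕ) : ℤ) :=
    Summable.of_nonneg_of_le (fun k => hf _) (fun k => by push_cast; exact hfu k) hu.summable
  have hs2 : Summable fun k : ℕ => f (-(((k + m : ℕ) : ℤ) + 1)) :=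
    Summable.of_nonneg_of_le (fun k => hf _) (fun k => by push_cast; exact hfv k) hv.summable
  have hs1' : Summable fun k : ℕ => f k := (summable_nat_add_iff (n + 1)).1 hs1
  have hs2' : Summable fun k : ℕ => f (-((k : ℤ) + 1)) :=
    (summable_nat_add_iff (f := fun k : ℕ => f (-((k : ℤ) + 1))) m).1 hs2
  have h1 := hs1'.sum_add_tsum_nat_add (n + 1)
  have h2 := hs2'.sum_add_tsum_nat_add m
  have h3 := tsum_of_nat_of_neg_add_one hs1' hs2'
  have b1 : ∑' k : ℕ, f ((k + (n + 1) : ℕ) : ℤ) ≤ U :=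
    hasSum_le (fun k => by push_cast; exact hfu k) hs1.hasSum hu
  have b2 : ∑' k : ℕ, f (-(((k + m : ℕ) : ℤ) + 1)) ≤ V :=
    hasSum_le (fun k => by push_cast; exact hfv k) hs2.hasSum hv
  have p1 : 0 ≤ ∑' k : ℕ, f ((k + (n + 1) : ℕ) : ℤ) := tsum_nonneg fun k => hf _
  have p2 : 0 ≤ ∑' k : ℕ, f (-(((k + m : ℕ) : ℤ) + 1)) := tsum_nonneg fun k => hf _
  rw [sum_Icc_neg_eq_add, abs_le]
  constructor <;> linarith

theorem hasSum_exp_neg_arith {κ : ℝ} (hκ : 0 < κ) (s : ℝ) :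
    HasSum (fun k : ℕ => Real.exp (-(s + (k + 1) * κ))) (Real.exp (-s) / (Real.exp κ - 1)) := by
  have h1 : Real.exp (-κ) < 1 := Real.exp_lt_one_iff.2 (by linarith)
  have h2 : 1 < Real.exp κ := Real.one_lt_exp_iff.2 hκ
  have h := (hasSum_geometric_of_lt_one (Real.exp_pos (-κ)).le h1).mul_left
    (Real.exp (-s) * Real.exp (-κ))
  have e : Real.exp (-s) * Real.exp (-κ) * (1 - Real.exp (-κ))⁻¹ =
      Real.exp (-s) / (Real.exp κ - 1) := by
    rw [Real.exp_neg κ]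
    have : Real.exp κ - 1 ≠ 0 := by linarith
    have : 1 - (Real.exp κ)⁻¹ ≠ 0 := by
      rw [← Real.exp_neg]; linarith
    field_simp
  rw [e] at h
  refine (congrArg (fun f : ℕ → ℝ => HasSum f _) (funext fun k => ?_)).mpr h
  rw [← Real.exp_nat_mul, ← Real.exp_add, ← Real.exp_add]
  congr 1
  ring

/-- A convex power lies above its tangent. -/
theorem tangent_le_rpow {p x y : ℝ} (hp : 1 ≤ p) (hx : 0 < x) (hy : 0 ≤ y) :
    x ^ p + (y - x) * (p * x ^ p / x) ≤ y ^ p := by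
  have hyx : 0 ≤ y / x := by positivity
  have h := one_add_mul_self_le_rpow_one_add (s := y / x - 1) (by linarith) hp
  rw [add_sub_cancel, Real.div_rpow hy hx.le, le_div_iff₀ (Real.rpow_pos_of_pos hx p)] at h
  refine le_trans (le_of_eq ?_) h
  field_simp

/-- Truncation error of the sinc quadrature for the majorant, with the tangent slope of
`x ^ (1 / α)` at the upper cut-off as rate of the geometric majorant. -/
theorem abs_tsum_majorant_sub_sum_le {α ξ h : ℝ} {m n : ℕ} (hα0 : 0 < α) (hα1 : α ≤ 1)
    (hξ : 1 ≤ ξ) (hh : 0 < h) (hn : 0 < n) :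
    |∑' j : ℤ, majorant α ξ (j * h) -
        ∑ j ∈ Finset.Icc (-(m : ℤ)) n, majorant α ξ (j * h)| ≤
      Real.exp (-((n * h) ^ (1 / α))) / (Real.exp ((n * h) ^ (1 / α) / (α * n)) - 1) +
        Real.exp (-(m * h)) / (Real.exp h - 1) := by
  have hn' : (0 : ℝ) < n := Nat.cast_pos.2 hn
  have hT : (0 : ℝ) < n * h := by positivity
  have hS := Real.rpow_pos_of_pos hT (1 / α)
  refine abs_tsum_int_sub_sum_Icc_le (fun j => (majorant_pos _ _ _).le)
    (hasSum_exp_neg_arith (by positivity) _) (hasSum_exp_neg_arith hh _) (fun k => ?_) fun k => ?_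
  · have hx : 0 ≤ (((k : ℤ) + (n + 1) : ℤ) : ℝ) * h := by positivity
    refine (majorant_le_exp_neg hα0 (by linarith) hx).trans (Real.exp_le_exp.2 ?_)
    have h1 := tangent_le_rpow (p := 1 / α) (by rw [le_div_iff₀ hα0]; linarith) hT hx
    have h2 : ((((k : ℤ) + (n + 1) : ℤ) : ℝ) * h) ^ (1 / α) ≤
        ξ * ((((k : ℤ) + (n + 1) : ℤ) : ℝ) * h) ^ (1 / α) :=
      le_mul_of_one_le_left (Real.rpow_nonneg hx _) hξ
    have e : ((((k : ℤ) + (n + 1) : ℤ) : ℝ) * h - n * h) *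
        (1 / α * (n * h) ^ (1 / α) / (n * h)) = (k + 1) * ((n * h) ^ (1 / α) / (α * n)) := by
      push_cast
      field_simp
      ring
    rw [e] at h1
    linarith
  · refine (majorant_le_exp (by linarith) _).trans (Real.exp_le_exp.2 (le_of_eq ?_))
    push_cast
    ring

theorem approx_eq (α d ε ξ : ℝ) : approx α d ε ξ =
    (((Real.Gamma (α + 1))⁻¹ * (step d ε * ∑ j ∈ Finset.Icc (-(Nminus d ε : ℤ)) (Nplus α d ε : ℤ),
      majorant α ξ (j * step d ε)) : ℝ) : ℂ) := by
  rw [approx, truncSinc, ← Finset.sum_div]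
  push_cast
  simp_rw [← g_ofReal]
  push_cast
  ring

theorem err_eq {α : ℝ} (hα : 0 < α) (d ε ξ : ℝ) : err α d ε ξ = (Real.Gamma (α + 1))⁻¹ *
    |ξ ^ (-α) * Real.Gamma (α + 1) - step d ε *
      ∑ j ∈ Finset.Icc (-(Nminus d ε : ℤ)) (Nplus α d ε : ℤ), majorant α ξ (j * step d ε)| := by
  have hΓ := Real.Gamma_pos_of_pos (show 0 < α + 1 by linarith)
  rw [err, approx_eq, ← ofReal_sub, norm_real, Real.norm_eq_abs, ← abs_of_pos (inv_pos.2 hΓ),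
    ← abs_mul, abs_of_pos (inv_pos.2 hΓ)]
  congr 1
  field_simp

/-- At a real node, `ξ` enters `g` only linearly in the exponent: the node `jh` gives the exponent
`softplus (jh) ^ (1/α)` and a weight proportional to `sigmoid (jh)`. -/
theorem exists_exponential_sum {α d ε : ℝ} (hα : 0 < α) (hh : 0 < step d ε) :
    ∃ w b : Fin (numTerms α d ε) → ℝ, (∀ j, 0 < w j ∧ 0 < b j) ∧
      ∀ ξ : ℝ, approx α d ε ξ = ((∑ j, w j * Real.exp (-(b j) * ξ) : ℝ) : ℂ) := by
  have hΓ := Real.Gamma_pos_of_pos (show 0 < α + 1 by linarith)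
  set h := step d ε
  set s := Finset.Icc (-(Nminus d ε : ℤ)) (Nplus α d ε : ℤ) with hs
  have hcard : s.card = numTerms α d ε := by
    rw [hs, Int.card_Icc, numTerms]
    omega
  let e := s.equivFinOfCardEq hcard
  refine ⟨fun i => (Real.Gamma (α + 1))⁻¹ * h * Real.sigmoid ((e.symm i : ℤ) * h),
    fun i => softplus ((e.symm i : ℤ) * h) ^ (1 / α), fun i => ⟨?_, ?_⟩, fun ξ => ?_⟩
  · have := Real.sigmoid_pos ((e.symm i : ℤ) * h)
    positivity
  · exact Real.rpow_pos_of_pos (softplus_pos _) _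
  · rw [approx_eq, ofReal_inj, Finset.mul_sum, Finset.mul_sum, ← Finset.sum_coe_sort s]
    refine Fintype.sum_equiv e _ _ fun j => ?_
    simp only [majorant, Equiv.symm_apply_apply]
    rw [show -ξ * softplus (j * h) ^ (1 / α) = -(softplus (j * h) ^ (1 / α)) * ξ by ring]
    ring

/-! ### Step, cut-offs and the error for every `ε < 1` -/

section Parameters

variable {α d ε : ℝ}

theorem log_inv_pos (h0 : 0 < ε) (h1 : ε < 1) : 0 < Real.log ε⁻¹ :=
  Real.log_pos ((one_lt_inv₀ h0).2 h1)

theorem step_pos (hd0 : 0 < d) (h0 : 0 < ε) (h1 : ε < 1) : 0 < step d ε := by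
  have := log_inv_pos h0 h1
  have := Real.pi_pos
  rw [step]
  positivity

theorem div_step (hd0 : 0 < d) : 2 * Real.pi * d / step d ε = Real.log ε⁻¹ := by
  have := Real.pi_pos
  rw [step, div_div_cancel₀ (by positivity)]

theorem exp_neg_log_inv (h0 : 0 < ε) : Real.exp (-Real.log ε⁻¹) = ε := by
  rw [Real.log_inv, neg_neg, Real.exp_log h0]

theorem cos_pi_div_four_le_beta (hα0 : 0 < α) (hd0 : 0 < d) (hd : d ≤ Real.pi * α / 8) :
    Real.cos (Real.pi / 4) ≤ beta α d := by
  have := Real.pi_pos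
  refine Real.cos_le_cos_of_nonneg_of_le_pi (by positivity) (by linarith) ?_
  rw [div_le_iff₀ hα0]
  linarith

theorem beta_pos (hα0 : 0 < α) (hd0 : 0 < d) (hd : d ≤ Real.pi * α / 8) : 0 < beta α d := by
  have h := cos_pi_div_four_le_beta hα0 hd0 hd
  rw [Real.cos_pi_div_four] at h
  have : 0 < √2 / 2 := by positivity
  linarith

theorem beta_le_one : beta α d ≤ 1 := Real.cos_le_one _

theorem log_inv_le_Nminus_mul_step (hd0 : 0 < d) (h0 : 0 < ε) (h1 : ε < 1) :
    Real.log ε⁻¹ ≤ Nminus d ε * step d ε := by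
  have hh := step_pos hd0 h0 h1
  rw [← div_step (ε := ε) hd0]
  have := Nat.le_ceil (2 * Real.pi * d / step d ε ^ 2)
  calc 2 * Real.pi * d / step d ε = 2 * Real.pi * d / step d ε ^ 2 * step d ε := by field_simp
    _ ≤ _ := mul_le_mul_of_nonneg_right this hh.le

theorem Nplus_pos (hα0 : 0 < α) (hd0 : 0 < d) (hd : d ≤ Real.pi * α / 8) (h0 : 0 < ε)
    (h1 : ε < 1) : 0 < Nplus α d ε := by
  have hh := step_pos hd0 h0 h1
  have hb := beta_pos hα0 hd0 hd
  have := Real.pi_pos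
  exact Nat.ceil_pos.2 (by positivity)

theorem log_inv_le_Nplus_mul_step_rpow (hα0 : 0 < α) (hd0 : 0 < d) (hd : d ≤ Real.pi * α / 8)
    (h0 : 0 < ε) (h1 : ε < 1) : Real.log ε⁻¹ ≤ (Nplus α d ε * step d ε) ^ (1 / α) := by
  have hh := step_pos hd0 h0 h1
  have hb := beta_pos hα0 hd0 hd
  have hpi := Real.pi_pos
  have hL := log_inv_pos h0 h1
  have hx : 0 ≤ 2 * Real.pi * d * step d ε ^ (-((α + 1) / α)) / beta α d := by positivity
  have hN : (2 * Real.pi * d * step d ε ^ (-((α + 1) / α)) / beta α d) ^ α ≤ Nplus α d ε :=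
    Nat.le_ceil _
  have h2 := Real.rpow_le_rpow (Real.rpow_nonneg hx _) hN (show 0 ≤ 1 / α by positivity)
  rw [← Real.rpow_mul hx, mul_one_div_cancel hα0.ne', Real.rpow_one] at h2
  rw [Real.mul_rpow (Nat.cast_nonneg _) hh.le]
  have h3 := mul_le_mul_of_nonneg_right h2 (Real.rpow_nonneg hh.le (1 / α))
  refine le_trans ?_ h3
  have e : step d ε ^ (-((α + 1) / α)) * step d ε ^ (1 / α) = (step d ε)⁻¹ := by
    rw [← Real.rpow_add hh, ← Real.rpow_neg_one]
    congr 1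
    field_simp
    ring
  have e2 : 2 * Real.pi * d * step d ε ^ (-((α + 1) / α)) / beta α d * step d ε ^ (1 / α) =
      Real.log ε⁻¹ / beta α d := by
    rw [← div_step (ε := ε) hd0, div_eq_mul_inv (2 * Real.pi * d) (step d ε), ← e]
    ring
  -- The cut-off even yields `log (1/ε) / β`; only `β ≤ 1` is used.
  rw [e2, le_div_iff₀ hb]
  nlinarith [beta_le_one (α := α) (d := d)]

/-- The error is bounded by the discretization error plus both truncation errors. -/
theorem err_le_discretization_add_truncation {ξ : ℝ} (hα0 : 0 < α) (hα1 : α < 1) (hd0 : 0 < d)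
    (hd : d ≤ Real.pi * α / 8) (h0 : 0 < ε) (h1 : ε < 1) (hξ : 1 ≤ ξ) :
    err α d ε ξ ≤ (Real.Gamma (α + 1))⁻¹ * (stripNorm d (g α ξ) * (ε / (1 - ε)) +
      step d ε * (ε / (Real.exp (step d ε) - 1)) +
      step d ε * (ε / (Real.exp ((Nplus α d ε * step d ε) ^ (1 / α) / (α * Nplus α d ε)) - 1))) := by
  have hh := step_pos hd0 h0 h1
  have hΓ := Real.Gamma_pos_of_pos (show 0 < α + 1 by linarith)
  have hn := Nplus_pos hα0 hd0 hd h0 h1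
  have hn' : (0 : ℝ) < Nplus α d ε := Nat.cast_pos.2 hn
  have hε := exp_neg_log_inv h0
  have hdisc := abs_sub_trapezoidal_majorant_le hα0 hα1 hd0 hd hξ hh
    (q := ε) (by rw [div_step hd0, hε])
  have htr := abs_tsum_majorant_sub_sum_le (m := Nminus d ε) hα0 hα1.le hξ hh hn
  rw [err_eq hα0]
  refine mul_le_mul_of_nonneg_left ?_ (inv_pos.2 hΓ).le
  set h := step d ε
  set κ := (Nplus α d ε * h) ^ (1 / α) / (α * Nplus α d ε) with hκ
  have hκ0 : 0 < κ := by positivity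
  have hd1 : 0 < Real.exp κ - 1 := by linarith [Real.one_lt_exp_iff.2 hκ0]
  have hd2 : 0 < Real.exp h - 1 := by linarith [Real.one_lt_exp_iff.2 hh]
  have b1 : Real.exp (-((Nplus α d ε * h) ^ (1 / α))) / (Real.exp κ - 1) ≤
      ε / (Real.exp κ - 1) := by
    refine div_le_div_of_nonneg_right ?_ hd1.le
    calc _ ≤ Real.exp (-Real.log ε⁻¹) := Real.exp_le_exp.2
          (neg_le_neg (log_inv_le_Nplus_mul_step_rpow hα0 hd0 hd h0 h1))
      _ = ε := hε
  have b2 : Real.exp (-(Nminus d ε * h)) / (Real.exp h - 1) ≤ ε / (Real.exp h - 1) := by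
    refine div_le_div_of_nonneg_right ?_ hd2.le
    calc _ ≤ Real.exp (-Real.log ε⁻¹) := Real.exp_le_exp.2
          (neg_le_neg (log_inv_le_Nminus_mul_step hd0 h0 h1))
      _ = ε := hε
  have b3 := mul_le_mul_of_nonneg_left (htr.trans (add_le_add b1 b2)) hh.le
  rw [← abs_of_pos hh, ← abs_mul, abs_of_pos hh, mul_sub] at b3
  have := abs_sub_le (ξ ^ (-α) * Real.Gamma (α + 1))
    (h * ∑' j : ℤ, majorant α ξ (j * h))
    (h * ∑ j ∈ Finset.Icc (-(Nminus d ε : ℤ)) (Nplus α d ε : ℤ), majorant α ξ (j * h))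
  linarith

/-- The cubic Taylor polynomial suffices: `x - x²/2 + x³/6` equals `x (x - 3/2)² / 6` plus a
nonnegative multiple of `x`. -/
theorem sq_le_exp_sub_one {x : ℝ} (hx : 0 ≤ x) : x ^ 2 ≤ Real.exp x - 1 := by
  have h := Real.sum_le_exp_of_nonneg hx 4
  simp [Finset.sum_range_succ, Nat.factorial] at h
  nlinarith [mul_nonneg hx (sq_nonneg (x - 3 / 2))]

/-- Since `α * n ≤ n ≤ n ^ (1/α)` for `n ≥ 1`. This replaces the tangent rate of the right tail by a
quantity free of `N_+`. -/
theorem step_rpow_le_tangent_slope (hα0 : 0 < α) (hα1 : α < 1) (hd0 : 0 < d)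
    (hd : d ≤ Real.pi * α / 8) (h0 : 0 < ε) (h1 : ε < 1) :
    step d ε ^ (1 / α) ≤ (Nplus α d ε * step d ε) ^ (1 / α) / (α * Nplus α d ε) := by
  have hh := step_pos hd0 h0 h1
  have hn : (1 : ℝ) ≤ Nplus α d ε := by
    exact_mod_cast Nplus_pos hα0 hd0 hd h0 h1
  have h2 : (Nplus α d ε : ℝ) ≤ (Nplus α d ε : ℝ) ^ (1 / α) :=
    Real.self_le_rpow_of_one_le hn (by rw [le_div_iff₀ hα0]; linarith)
  rw [Real.mul_rpow (by linarith) hh.le, le_div_iff₀ (by positivity), mul_comm]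
  refine mul_le_mul_of_nonneg_right ?_ (Real.rpow_nonneg hh.le _)
  nlinarith

theorem err_le {ξ : ℝ} (hα0 : 0 < α) (hα1 : α < 1) (hd0 : 0 < d)
    (hd : d ≤ Real.pi * α / 8) (h0 : 0 < ε) (h1 : ε < 1) (hξ : 1 ≤ ξ) :
    err α d ε ξ ≤ (Real.Gamma (α + 1))⁻¹ * (stripNorm d (g α ξ) / (1 - ε) + 1 / step d ε
      + 1 / (beta α d * step d ε ^ (1 / α))) * ε := by
  have hh := step_pos hd0 h0 h1
  have hb := beta_pos hα0 hd0 hd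
  have hb1 := beta_le_one (α := α) (d := d)
  have hΓ := Real.Gamma_pos_of_pos (show 0 < α + 1 by linarith)
  have hslope := step_rpow_le_tangent_slope hα0 hα1 hd0 hd h0 h1
  refine (err_le_discretization_add_truncation hα0 hα1 hd0 hd h0 h1 hξ).trans ?_
  rw [mul_assoc]
  refine mul_le_mul_of_nonneg_left ?_ (inv_pos.2 hΓ).le
  set h := step d ε
  set κ := (Nplus α d ε * h) ^ (1 / α) / (α * Nplus α d ε)
  set H := h ^ (1 / α) with hH
  have hH0 : 0 < H := Real.rpow_pos_of_pos hh _
  have hd1 : 0 < Real.exp H - 1 := by linarith [Real.one_lt_exp_iff.2 hH0]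
  have hd2 : 0 < Real.exp h - 1 := by linarith [Real.one_lt_exp_iff.2 hh]
  have hleft : h * (ε / (Real.exp h - 1)) ≤ 1 / h * ε := by
    rw [← mul_div_assoc, div_le_iff₀ hd2, one_div_mul_eq_div, div_mul_eq_mul_div, le_div_iff₀ hh]
    nlinarith [sq_le_exp_sub_one hh.le]
  -- For `h ≤ 1` the linear bound on `exp` is enough; for `h ≥ 1` one has `h ≤ H`, and the quadratic
  -- bound applies.
  have hhH : h * H ≤ Real.exp H - 1 := by
    rcases le_total h 1 with hle | hle
    · have := Real.add_one_le_exp H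
      nlinarith
    · have h2 : h ≤ H := Real.self_le_rpow_of_one_le hle (by rw [le_div_iff₀ hα0]; linarith)
      nlinarith [sq_le_exp_sub_one hH0.le]
  have hright : h * (ε / (Real.exp κ - 1)) ≤ 1 / (beta α d * H) * ε := by
    have h2 : h * (ε / (Real.exp κ - 1)) ≤ h * (ε / (Real.exp H - 1)) := by
      gcongr
    refine h2.trans ?_
    rw [← mul_div_assoc, div_le_iff₀ hd1, one_div_mul_eq_div, div_mul_eq_mul_div,
      le_div_iff₀ (by positivity)]
    have h3 : h * (beta α d * H) ≤ Real.exp H - 1 := by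
      have : beta α d * (h * H) ≤ 1 * (h * H) :=
        mul_le_mul_of_nonneg_right hb1 (by positivity)
      linarith
    nlinarith
  have e : stripNorm d (g α ξ) * (ε / (1 - ε)) = stripNorm d (g α ξ) / (1 - ε) * ε := by ring
  rw [e]
  linarith

end Parameters

end SincExpSum

/-! ### Numerical bounds for the Gamma function and powers -/

namespace SincExpSum

open Filter Topology

/-- Log-convexity of Gamma at `2`, a convex combination of `α + 1` and `3`, gives `log Γ(α+1) ≥ -(1
- α) log 2`; then `log x ≤ x - 1`. -/
theorem one_sub_mul_log_two_le_Gamma {α : ℝ} (hα0 : 0 < α) (hα1 : α < 1) :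
    1 - (1 - α) * Real.log 2 ≤ Real.Gamma (α + 1) := by
  have hΓ := Real.Gamma_pos_of_pos (show 0 < α + 1 by linarith)
  have h2α : 0 < 2 - α := by linarith
  have h := Real.Gamma_mul_add_mul_le_rpow_Gamma_mul_rpow_Gamma (s := α + 1) (t := 3)
    (a := 1 / (2 - α)) (b := (1 - α) / (2 - α)) (by linarith) (by norm_num) (by positivity)
    (div_pos (by linarith) h2α) (by field_simp; ring)
  have e : 1 / (2 - α) * (α + 1) + (1 - α) / (2 - α) * 3 = 2 := by field_simp; ring
  have h3 : Real.Gamma 3 = 2 := by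
    rw [show (3 : ℝ) = 2 + 1 by norm_num, Real.Gamma_add_one two_ne_zero, Real.Gamma_two, mul_one]
  rw [e, Real.Gamma_two, h3] at h
  have h4 := Real.log_nonneg h
  rw [Real.log_mul (Real.rpow_pos_of_pos hΓ _).ne' (by positivity), Real.log_rpow hΓ,
    Real.log_rpow (by norm_num), div_mul_eq_mul_div, div_mul_eq_mul_div, ← add_div] at h4
  have h5 : 0 ≤ 1 * Real.log (Real.Gamma (α + 1)) + (1 - α) * Real.log 2 := by
    by_contra! hneg
    exact absurd h4 (not_le.2 (div_neg_of_neg_of_pos hneg h2α))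
  have h6 := Real.log_le_sub_one_of_pos hΓ
  linarith

theorem Gamma_add_one_le_one {α : ℝ} (hα0 : 0 < α) (hα1 : α < 1) : Real.Gamma (α + 1) ≤ 1 := by
  have h := Real.Gamma_mul_add_mul_le_rpow_Gamma_mul_rpow_Gamma (s := 1) (t := 2)
    (a := 1 - α) (b := α) (by linarith) (by norm_num) (by linarith) hα0 (by ring)
  rw [Real.Gamma_one, Real.Gamma_two, Real.one_rpow, Real.one_rpow, one_mul] at h
  rwa [show α + 1 = (1 - α) * 1 + α * 2 by ring]

theorem le_Gamma_add_one {α : ℝ} (hα0 : 0 < α) (hα1 : α < 1) : α ≤ Real.Gamma (α + 1) := by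
  have h := one_sub_mul_log_two_le_Gamma hα0 hα1
  have := Real.log_two_lt_d9
  nlinarith

theorem inv_rpow_inv_ge {α : ℝ} (hα0 : 0 < α) (hα1 : α < 1) :
    1 + (1 - α) + 2 * (1 - α) ^ 2 ≤ (1 / α) ^ (1 / α) := by
  have h1 : 1 ≤ 1 / α := by rw [le_div_iff₀ hα0]; linarith
  have h := one_add_mul_self_le_rpow_one_add (s := 1 / α - 1) (by linarith) h1
  rw [add_sub_cancel] at h
  refine le_trans ?_ h
  have hv : (1 - α) + (1 - α) ^ 2 ≤ 1 / α - 1 := by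
    rw [le_sub_iff_add_le, le_div_iff₀ hα0]
    nlinarith [mul_nonneg (sq_nonneg (1 - α)) (show 0 ≤ 1 - α by linarith)]
  nlinarith

/-! ### Error bounds for `ε < exp (-π²/4)` -/

section Small

variable {α d ε : ℝ}

theorem pi_sq_div_four_lt_log_inv (h0 : 0 < ε) (hε : ε < Real.exp (-(Real.pi ^ 2 / 4))) :
    Real.pi ^ 2 / 4 < Real.log ε⁻¹ := by
  have := Real.log_lt_log h0 hε
  rw [Real.log_exp] at this
  rw [Real.log_inv]
  linarith

theorem pi_sq_div_four_gt : 2.46 < Real.pi ^ 2 / 4 := by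
  nlinarith [Real.pi_gt_d2]

/-- Ensures `1 / (1 - ε) ≤ 1.1` in the discretization error. -/
theorem lt_one_div_eleven (hε : ε < Real.exp (-(Real.pi ^ 2 / 4))) : ε < 1 / 11 := by
  refine hε.trans ((Real.exp_lt_exp.2 (neg_lt_neg pi_sq_div_four_gt)).trans ?_)
  rw [Real.exp_neg, ← one_div]
  refine one_div_lt_one_div_of_lt (by norm_num) ?_
  have h1 := Real.exp_one_gt_d9
  have h2 := Real.quadratic_le_exp_of_nonneg (show (0 : ℝ) ≤ 0.46 by norm_num)
  rw [show (2.46 : ℝ) = 1 + 1 + 0.46 by norm_num, Real.exp_add, Real.exp_add]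
  have h3 : (2.7 : ℝ) * 2.7 ≤ Real.exp 1 * Real.exp 1 := by gcongr <;> linarith
  have h4 : (1.56 : ℝ) ≤ Real.exp 0.46 := by refine le_trans ?_ h2; norm_num
  have h5 : (2.7 : ℝ) * 2.7 * 1.56 ≤ Real.exp 1 * Real.exp 1 * Real.exp 0.46 := by gcongr
  refine lt_of_lt_of_le ?_ h5
  norm_num

/-- The threshold `π²/4` is exactly what turns `d ≤ πα/8` into `h < α`. -/
theorem step_lt (hα0 : 0 < α) (hd : d ≤ Real.pi * α / 8) (h0 : 0 < ε)
    (hε : ε < Real.exp (-(Real.pi ^ 2 / 4))) : step d ε < α := by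
  have hL := pi_sq_div_four_lt_log_inv h0 hε
  have hpi := Real.pi_pos
  rw [step, div_lt_iff₀ (lt_trans (by positivity) hL)]
  nlinarith

theorem err_le_of_small {ξ : ℝ} (hα0 : 0 < α) (hα1 : α < 1) (hd0 : 0 < d)
    (hd : d ≤ Real.pi * α / 8) (h0 : 0 < ε) (hε : ε < Real.exp (-(Real.pi ^ 2 / 4)))
    (hξ : 1 ≤ ξ) :
    err α d ε ξ ≤ (Real.Gamma (α + 1))⁻¹ *
      (1.1 * stripNorm d (g α ξ) + 1 / (1 + step d ε / 2) + α) * ε := by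
  have hε1 := lt_one_div_eleven hε
  have h1 : ε < 1 := by linarith
  have hh := step_pos hd0 h0 h1
  have hΓ := Real.Gamma_pos_of_pos (show 0 < α + 1 by linarith)
  have hL : 1 ≤ Real.log ε⁻¹ := by
    linarith [pi_sq_div_four_lt_log_inv h0 hε, pi_sq_div_four_gt]
  have hn := Nplus_pos hα0 hd0 hd h0 h1
  have hn' : (0 : ℝ) < Nplus α d ε := Nat.cast_pos.2 hn
  have hS := hL.trans (log_inv_le_Nplus_mul_step_rpow hα0 hd0 hd h0 h1)
  refine (err_le_discretization_add_truncation hα0 hα1 hd0 hd h0 h1 hξ).trans ?_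
  rw [mul_assoc]
  refine mul_le_mul_of_nonneg_left ?_ (inv_pos.2 hΓ).le
  have hN : 0 ≤ stripNorm d (g α ξ) :=
    add_nonneg (MeasureTheory.integral_nonneg fun t => norm_nonneg _)
      (MeasureTheory.integral_nonneg fun t => norm_nonneg _)
  set h := step d ε
  have hT : 0 < Nplus α d ε * h := by positivity
  set T := Nplus α d ε * h with hTdef
  set S := T ^ (1 / α) with hSdef
  have hTS : T ≤ S := by
    refine Real.self_le_rpow_of_one_le ?_ (by rw [le_div_iff₀ hα0]; linarith)
    by_contra! hlt
    exact absurd hS (not_le.2 (Real.rpow_lt_one hT.le hlt (by positivity)))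
  have hκ : 0 < S / (α * Nplus α d ε) := by positivity
  have b1 : stripNorm d (g α ξ) * (ε / (1 - ε)) ≤ 1.1 * stripNorm d (g α ξ) * ε := by
    have : ε / (1 - ε) ≤ 1.1 * ε := by
      rw [div_le_iff₀ (by linarith)]
      nlinarith
    nlinarith
  have b2 : h * (ε / (Real.exp h - 1)) ≤ 1 / (1 + h / 2) * ε := by
    have hq := Real.quadratic_le_exp_of_nonneg hh.le
    have : h * (1 + h / 2) ≤ Real.exp h - 1 := by nlinarith
    rw [← mul_div_assoc, div_le_iff₀ (by nlinarith), one_div_mul_eq_div, div_mul_eq_mul_div,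
      le_div_iff₀ (by positivity)]
    nlinarith
  -- Here `exp x - 1 ≥ x` leaves `α * T / S`, and `T ≤ S` because `S ≥ 1`. This is sharper than the
  -- general bound when `h` is small.
  have b3 : h * (ε / (Real.exp (S / (α * Nplus α d ε)) - 1)) ≤ α * ε := by
    have h2 : h * (ε / (Real.exp (S / (α * Nplus α d ε)) - 1)) ≤
        h * (ε / (S / (α * Nplus α d ε))) := by
      gcongr
      linarith [Real.add_one_le_exp (S / (α * Nplus α d ε))]
    refine h2.trans ?_
    have e : h * (ε / (S / (α * Nplus α d ε))) = α * ε * (T / S) := by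
      rw [hTdef]
      field_simp
    rw [e]
    exact mul_le_of_le_one_right (by positivity) ((div_le_one (by positivity)).2 hTS)
  linarith

theorem err_le_norm_of_small {ξ : ℝ} (hα0 : 0 < α) (hα1 : α < 1) (hd0 : 0 < d)
    (hd : d ≤ Real.pi * α / 8) (h0 : 0 < ε) (hε : ε < Real.exp (-(Real.pi ^ 2 / 4)))
    (hξ : 1 ≤ ξ) :
    err α d ε ξ ≤
      (stripNorm d (g α ξ) + 1 / step d ε + 1 / (beta α d * step d ε ^ (1 / α))) * ε := by
  have h1 : ε < 1 := by linarith [lt_one_div_eleven hε]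
  have hh := step_pos hd0 h0 h1
  have hhα := step_lt hα0 hd h0 hε
  have hΓ := Real.Gamma_pos_of_pos (show 0 < α + 1 by linarith)
  have hb := beta_pos hα0 hd0 hd
  have hb1 := beta_le_one (α := α) (d := d)
  have hN := stripNorm_g_le hα0 hα1 hd0 hd hξ
  have hG := one_sub_mul_log_two_le_Gamma hα0 hα1
  have hG1 := Gamma_add_one_le_one hα0 hα1
  have hGα := le_Gamma_add_one hα0 hα1
  refine (err_le_of_small hα0 hα1 hd0 hd h0 hε hξ).trans ?_
  refine mul_le_mul_of_nonneg_right ?_ h0.le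
  rw [inv_mul_le_iff₀ hΓ]
  set G := Real.Gamma (α + 1)
  set h := step d ε
  set H := h ^ (1 / α) with hH
  have hH0 : 0 < H := Real.rpow_pos_of_pos hh _
  have c1 : (1 / α) ^ (1 / α) ≤ 1 / (beta α d * H) := by
    have h2 : H ≤ α ^ (1 / α) := Real.rpow_le_rpow hh.le hhα.le (by positivity)
    rw [Real.div_rpow zero_le_one hα0.le, Real.one_rpow]
    refine one_div_le_one_div_of_le (by positivity) ?_
    nlinarith
  have c2 := inv_rpow_inv_ge hα0 hα1
  -- Dropping `1 / Γ(α+1)` leaves an excess of up to `2.54 * G * (1.1 - G)` from the strip norm and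
  -- `α ≤ G` from the right tail. The `1/h` term can spare `G / 3` (`c4`), and the last term covers
  -- the rest. With `u = 1 - α` this is a quadratic inequality whose slack is least near `u = 0.19`.
  have c3 : 2.54 * (1.1 - G) + 1 - 1 / 3 ≤ 1 / (beta α d * H) := by
    refine le_trans ?_ (c2.trans c1)
    have hlog := Real.log_two_lt_d9
    have : 1 - (1 - α) * 0.6932 ≤ G := by nlinarith
    nlinarith [sq_nonneg ((1 - α) - 0.19)]
  have c4 : 1 / (1 + h / 2) ≤ G * (1 / h - 1 / 3) := by
    have h3 : 0 < 1 / h - 1 / 3 := by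
      rw [sub_pos]
      exact one_div_lt_one_div_of_lt hh (by linarith)
    have h4 : h * (1 / h - 1 / 3) ≤ G * (1 / h - 1 / 3) :=
      mul_le_mul_of_nonneg_right (by linarith) h3.le
    refine le_trans ?_ h4
    rw [mul_sub, mul_one_div_cancel hh.ne', div_le_iff₀ (by positivity)]
    nlinarith
  have c5 := mul_le_mul_of_nonneg_left c3 hΓ.le
  have c6 : stripNorm d (g α ξ) * (1.1 - G) ≤ 2.54 * G * (1.1 - G) :=
    mul_le_mul_of_nonneg_right hN (by linarith)
  linarith

/-- After multiplication by `G = Γ(α+1)`: the strip norm costs `1.1 * 2.54 * G`, the left tail `1 ≤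
G / α`, the right tail `α ≤ G`. An error linear in `ε` with a constant independent of `d` serves
both remaining accuracy bounds. -/
theorem err_le_const_mul_of_small {ξ : ℝ} (hα0 : 0 < α) (hα1 : α < 1) (hd0 : 0 < d)
    (hd : d ≤ Real.pi * α / 8) (h0 : 0 < ε) (hε : ε < Real.exp (-(Real.pi ^ 2 / 4)))
    (hξ : 1 ≤ ξ) : err α d ε ξ ≤ (3.8 + 1 / α) * ε := by
  have h1 : ε < 1 := by linarith [lt_one_div_eleven hε]
  have hh := step_pos hd0 h0 h1
  have hΓ := Real.Gamma_pos_of_pos (show 0 < α + 1 by linarith)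
  have hN := stripNorm_g_le hα0 hα1 hd0 hd hξ
  have hGα := le_Gamma_add_one hα0 hα1
  refine (err_le_of_small hα0 hα1 hd0 hd h0 hε hξ).trans ?_
  refine mul_le_mul_of_nonneg_right ?_ h0.le
  rw [inv_mul_le_iff₀ hΓ]
  set G := Real.Gamma (α + 1)
  have h2 : 1 / (1 + step d ε / 2) ≤ 1 := by
    rw [div_le_one (by positivity)]
    linarith
  have h3 : 1 ≤ G * (1 / α) := by
    rw [mul_one_div, le_div_iff₀ hα0]
    linarith
  linarith

theorem err_le_log_of_small {ξ : ℝ} (hα0 : 0 < α) (hα1 : α < 1) (hd0 : 0 < d)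
    (hd : d ≤ Real.pi * α / 8) (h0 : 0 < ε) (hε : ε < Real.exp (-(Real.pi ^ 2 / 4)))
    (hξ : 1 ≤ ξ) :
    err α d ε ξ ≤ 2 * (1 + Real.log 2 + Real.Gamma (α + 1) / Real.cos (Real.pi / 8) ^ α
      + (Real.cos (Real.pi / 4))⁻¹ * (4 * Real.log ε⁻¹ / (Real.pi ^ 2 * α)) ^ (1 / α)) * ε := by
  have hpi := Real.pi_pos
  have hΓ := Real.Gamma_pos_of_pos (show 0 < α + 1 by linarith)
  refine (err_le_const_mul_of_small hα0 hα1 hd0 hd h0 hε hξ).trans ?_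
  refine mul_le_mul_of_nonneg_right ?_ h0.le
  have h1 : 1 ≤ 1 / α := by rw [le_div_iff₀ hα0]; linarith
  -- Since `log (1/ε) > π²/4`, the logarithmic term dominates `1/α`; of the Gamma quotient only
  -- positivity is needed.
  have hX : 1 / α ≤ 4 * Real.log ε⁻¹ / (Real.pi ^ 2 * α) := by
    have := pi_sq_div_four_lt_log_inv h0 hε
    rw [div_le_div_iff₀ hα0 (by positivity)]
    nlinarith
  have hX2 : 1 / α ≤ (4 * Real.log ε⁻¹ / (Real.pi ^ 2 * α)) ^ (1 / α) :=
    hX.trans (Real.self_le_rpow_of_one_le (h1.trans hX) h1)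
  have hc0 : 0 < Real.cos (Real.pi / 4) :=
    Real.cos_pos_of_mem_Ioo ⟨by linarith, by linarith⟩
  have hc : 1 ≤ (Real.cos (Real.pi / 4))⁻¹ := (one_le_inv₀ hc0).2 (Real.cos_le_one _)
  have hX3 : (4 * Real.log ε⁻¹ / (Real.pi ^ 2 * α)) ^ (1 / α) ≤
      (Real.cos (Real.pi / 4))⁻¹ * (4 * Real.log ε⁻¹ / (Real.pi ^ 2 * α)) ^ (1 / α) :=
    le_mul_of_one_le_left (by linarith) hc
  have h8 : 0 < Real.Gamma (α + 1) / Real.cos (Real.pi / 8) ^ α :=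
    div_pos hΓ (Real.rpow_pos_of_pos
      (Real.cos_pos_of_mem_Ioo ⟨by linarith, by linarith⟩) _)
  have hlog := Real.log_two_gt_d9
  linarith

end Small

/-! ### Number of terms and accuracy in terms of it -/

section NumTerms

variable {α d ε : ℝ}

theorem two_pi_d_mul_div_step_sq (hd0 : 0 < d) (h0 : 0 < ε) (h1 : ε < 1) :
    2 * Real.pi * d * (2 * Real.pi * d / step d ε ^ 2) = Real.log ε⁻¹ ^ 2 := by
  have hh := step_pos hd0 h0 h1
  rw [← div_step (ε := ε) hd0]
  field_simp

theorem two_pi_d_mul_Nplus_arg (hα0 : 0 < α) (hd0 : 0 < d) (hd : d ≤ Real.pi * α / 8)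
    (h0 : 0 < ε) (h1 : ε < 1) :
    2 * Real.pi * d * (2 * Real.pi * d * step d ε ^ (-((α + 1) / α)) / beta α d) ^ α =
      (beta α d ^ α)⁻¹ * Real.log ε⁻¹ ^ (1 + α) := by
  have hh := step_pos hd0 h0 h1
  have hb := beta_pos hα0 hd0 hd
  have hL := log_inv_pos h0 h1
  have hpi := Real.pi_pos
  have hD : 0 < 2 * Real.pi * d := by positivity
  rw [Real.div_rpow (by positivity) hb.le, Real.mul_rpow hD.le (by positivity),
    ← Real.rpow_mul hh.le, show -((α + 1) / α) * α = -(1 + α) by field_simp; ring,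
    Real.rpow_neg hh.le, ← div_step (ε := ε) hd0, Real.div_rpow hD.le hh.le,
    Real.rpow_add hD, Real.rpow_one]
  ring

theorem sq_log_inv_le_mul_numTerms (hd0 : 0 < d) (h0 : 0 < ε) (h1 : ε < 1) :
    Real.log ε⁻¹ ^ 2 ≤ 2 * Real.pi * d * numTerms α d ε := by
  have hpi := Real.pi_pos
  rw [← two_pi_d_mul_div_step_sq hd0 h0 h1]
  refine mul_le_mul_of_nonneg_left ?_ (by positivity)
  have h2 : 2 * Real.pi * d / step d ε ^ 2 ≤ Nminus d ε := Nat.le_ceil _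
  rw [numTerms]
  push_cast
  have : (0 : ℝ) ≤ Nplus α d ε := Nat.cast_nonneg _
  linarith

/-- The `3` collects the two ceilings and the node `j = 0`. -/
theorem mul_numTerms_le (hα0 : 0 < α) (hd0 : 0 < d) (hd : d ≤ Real.pi * α / 8)
    (h0 : 0 < ε) (h1 : ε < 1) :
    2 * Real.pi * d * numTerms α d ε ≤ Real.log ε⁻¹ ^ 2 +
      (beta α d ^ α)⁻¹ * Real.log ε⁻¹ ^ (1 + α) + 2 * Real.pi * d * 3 := by
  have hpi := Real.pi_pos
  have hh := step_pos hd0 h0 h1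
  have hb := beta_pos hα0 hd0 hd
  rw [← two_pi_d_mul_div_step_sq hd0 h0 h1, ← two_pi_d_mul_Nplus_arg hα0 hd0 hd h0 h1,
    ← mul_add, ← mul_add]
  refine mul_le_mul_of_nonneg_left ?_ (by positivity)
  have h2 : (Nminus d ε : ℝ) < 2 * Real.pi * d / step d ε ^ 2 + 1 :=
    Nat.ceil_lt_add_one (by positivity)
  have h3 : (Nplus α d ε : ℝ) <
      (2 * Real.pi * d * step d ε ^ (-((α + 1) / α)) / beta α d) ^ α + 1 :=
    Nat.ceil_lt_add_one (by positivity)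
  rw [numTerms]
  push_cast
  linarith

theorem tendsto_log_inv : Tendsto (fun ε : ℝ => Real.log ε⁻¹) (𝓝[>] 0) atTop :=
  Real.tendsto_log_atTop.comp tendsto_inv_nhdsGT_zero

/-- After division by `log² (1/ε)` the contribution of `N_+` is of order `log (1/ε) ^ (α - 1)`,
which tends to `0` because `α < 1`. -/
theorem tendsto_mul_numTerms_div_sq_log (hα0 : 0 < α) (hα1 : α < 1) (hd0 : 0 < d)
    (hd : d ≤ Real.pi * α / 8) :
    Tendsto (fun ε => 2 * Real.pi * d * numTerms α d ε / Real.log ε⁻¹ ^ 2) (𝓝[>] 0) (𝓝 1) := by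
  have hev : ∀ᶠ ε : ℝ in 𝓝[>] 0, 0 < ε ∧ ε < 1 := Ioo_mem_nhdsGT one_pos
  have hup : Tendsto (fun x : ℝ => 1 + (beta α d ^ α)⁻¹ * x ^ (-(1 - α)) +
      2 * Real.pi * d * 3 * x ^ (-2 : ℝ)) atTop (𝓝 1) := by
    have h1 := (tendsto_rpow_neg_atTop (show 0 < 1 - α by linarith)).const_mul (beta α d ^ α)⁻¹
    have h2 := (tendsto_rpow_neg_atTop (show (0 : ℝ) < 2 by norm_num)).const_mul
      (2 * Real.pi * d * 3)
    simpa using (h1.const_add 1).add h2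
  refine tendsto_of_tendsto_of_tendsto_of_le_of_le' tendsto_const_nhds (hup.comp tendsto_log_inv)
    ?_ ?_
  · filter_upwards [hev] with ε ⟨h0, h1⟩
    rw [one_le_div (pow_pos (log_inv_pos h0 h1) 2)]
    exact sq_log_inv_le_mul_numTerms hd0 h0 h1
  · filter_upwards [hev] with ε ⟨h0, h1⟩
    have hL := log_inv_pos h0 h1
    rw [div_le_iff₀ (pow_pos hL 2)]
    refine (mul_numTerms_le hα0 hd0 hd h0 h1).trans (le_of_eq ?_)
    have e1 : Real.log ε⁻¹ ^ (1 + α) = Real.log ε⁻¹ ^ (-(1 - α)) * Real.log ε⁻¹ ^ 2 := by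
      rw [← Real.rpow_natCast, ← Real.rpow_add hL]
      congr 1
      push_cast
      ring
    have e2 : Real.log ε⁻¹ ^ (-2 : ℝ) * Real.log ε⁻¹ ^ 2 = 1 := by
      rw [← Real.rpow_natCast, ← Real.rpow_add hL]
      norm_num
    simp only [Function.comp]
    rw [e1]
    linear_combination (-(2 * Real.pi * d * 3)) * e2

theorem numTerms_isEquivalent (hα0 : 0 < α) (hα1 : α < 1) (hd0 : 0 < d)
    (hd : d ≤ Real.pi * α / 8) :
    Asymptotics.IsEquivalent (𝓝[>] 0) (fun ε => (numTerms α d ε : ℝ))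
      (fun ε => Real.log ε⁻¹ ^ 2 / (2 * Real.pi * d)) := by
  have hpi := Real.pi_pos
  refine Asymptotics.isEquivalent_of_tendsto_one
    ((tendsto_mul_numTerms_div_sq_log hα0 hα1 hd0 hd).congr fun ε => ?_)
  simp only [Pi.div_apply]
  field_simp

theorem log_inv_isEquivalent (hα0 : 0 < α) (hα1 : α < 1) (hd0 : 0 < d)
    (hd : d ≤ Real.pi * α / 8) :
    Asymptotics.IsEquivalent (𝓝[>] 0) (fun ε => Real.log ε⁻¹)
      (fun ε => √(2 * Real.pi * d * numTerms α d ε)) := by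
  have h := (tendsto_mul_numTerms_div_sq_log hα0 hα1 hd0 hd).sqrt.inv₀ (by simp)
  rw [Real.sqrt_one, inv_one] at h
  refine Asymptotics.isEquivalent_of_tendsto_one (h.congr' ?_)
  filter_upwards [Ioo_mem_nhdsGT one_pos] with ε ⟨h0, h1⟩
  have hL := log_inv_pos h0 h1
  rw [Real.sqrt_div' _ (by positivity), Real.sqrt_sq hL.le, inv_div, Pi.div_apply]

theorem exists_accuracy_constant (hα0 : 0 < α) (hα1 : α < 1) (hd0 : 0 < d)
    (hd : d ≤ Real.pi * α / 8) :
    ∃ C : ℝ, 0 < C ∧ ∀ ε : ℝ, 0 < ε → ε < Real.exp (-(Real.pi ^ 2 / 4)) →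
      Real.exp (-√(2 * Real.pi * d * numTerms α d ε)) ≤ ε ∧
      ε ≤ Real.exp (-√(2 * Real.pi * d * numTerms α d ε)
        + C * (numTerms α d ε : ℝ) ^ (α / 2)) ∧
      ∀ ξ : ℝ, 1 ≤ ξ → err α d ε ξ ≤
        C * Real.exp (-√(2 * Real.pi * d * numTerms α d ε)
          + C * (numTerms α d ε : ℝ) ^ (α / 2)) := by
  have hpi := Real.pi_pos
  have hb := beta_pos hα0 hd0 hd
  have hD : 0 < 2 * Real.pi * d := by positivity
  set D := 2 * Real.pi * d with hDdef
  set b := (beta α d ^ α)⁻¹ with hbdef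
  have hb0 : 0 < b := inv_pos.2 (Real.rpow_pos_of_pos hb _)
  -- Chosen so that the cross term of `(L + B * L ^ α) ^ 2` is `(b + 3 * D) * L ^ (1 + α)`, which
  -- absorbs both lower-order terms of `D * N` as `L ≥ 1`.
  set B := (b + D * 3) / 2 with hB
  have hB0 : 0 < B := by positivity
  set C₁ := B * D ^ (α / 2) with hC₁
  have hC₁0 : 0 < C₁ := by positivity
  have hK : 0 < 3.8 + 1 / α := by positivity
  -- One constant plays two roles: `C₁` is needed in the exponent and `3.8 + 1 / α` as prefactor of
  -- the error.
  refine ⟨C₁ + (3.8 + 1 / α), by positivity, fun ε h0 hε => ?_⟩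
  have h1 : ε < 1 := by linarith [lt_one_div_eleven hε]
  have hL : 1 ≤ Real.log ε⁻¹ := by
    linarith [pi_sq_div_four_lt_log_inv h0 hε, pi_sq_div_four_gt]
  have hlow := sq_log_inv_le_mul_numTerms (α := α) hd0 h0 h1
  have hup := mul_numTerms_le hα0 hd0 hd h0 h1
  have hεeq := exp_neg_log_inv h0
  rw [← hDdef] at hlow hup
  rw [← hbdef] at hup
  set L := Real.log ε⁻¹
  set N : ℝ := (numTerms α d ε : ℝ) with hN
  have hN0 : 0 ≤ N := Nat.cast_nonneg _
  have hLs : L ≤ √(D * N) := Real.le_sqrt_of_sq_le hlow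
  have hLα : L ^ α ≤ D ^ (α / 2) * N ^ (α / 2) := by
    rw [← Real.mul_rpow hD.le hN0]
    refine (Real.rpow_le_rpow (by linarith) hLs hα0.le).trans (le_of_eq ?_)
    rw [Real.sqrt_eq_rpow, ← Real.rpow_mul (by positivity)]
    congr 1
    ring
  have hsq : √(D * N) ≤ L + B * L ^ α := by
    refine Real.sqrt_le_iff.2 ⟨by positivity, hup.trans ?_⟩
    have e : L ^ (1 + α) = L * L ^ α := by rw [Real.rpow_add (by linarith), Real.rpow_one]
    have h2 : 1 ≤ L ^ (1 + α) := Real.one_le_rpow hL (by linarith)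
    have h3 : D * 3 ≤ D * 3 * L ^ (1 + α) := le_mul_of_one_le_right (by positivity) h2
    have h4 : (L + B * L ^ α) ^ 2 =
        L ^ 2 + b * L ^ (1 + α) + D * 3 * L ^ (1 + α) + (B * L ^ α) ^ 2 := by
      rw [e, hB]
      ring
    rw [h4]
    nlinarith [sq_nonneg (B * L ^ α)]
  have hNα : 0 ≤ N ^ (α / 2) := Real.rpow_nonneg hN0 _
  have hmain : ε ≤ Real.exp (-√(D * N) + (C₁ + (3.8 + 1 / α)) * N ^ (α / 2)) := by
    rw [← hεeq]
    refine Real.exp_le_exp.2 ?_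
    have h5 : B * L ^ α ≤ C₁ * N ^ (α / 2) := by
      rw [hC₁, mul_assoc]
      exact mul_le_mul_of_nonneg_left hLα hB0.le
    have h6 : 0 ≤ (3.8 + 1 / α) * N ^ (α / 2) := by positivity
    linarith
  refine ⟨?_, hmain, fun ξ hξ => ?_⟩
  · calc Real.exp (-√(D * N)) ≤ Real.exp (-L) := Real.exp_le_exp.2 (by linarith)
      _ = ε := hεeq
  · refine (err_le_const_mul_of_small hα0 hα1 hd0 hd h0 hε hξ).trans ?_
    exact mul_le_mul (by linarith) hmain h0.le (by positivity)

end NumTerms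

end SincExpSum

open SincExpSum in
theorem theorem2p6 (α d : ℝ) (hα0 : 0 < α) (hα1 : α < 1)
    (hd0 : 0 < d) (hd : d ≤ Real.pi * α / 8) :
    Real.cos (Real.pi / 4) ≤ beta α d ∧
    -- the boundary norm of `g` is finite
    (∀ ξ : ℝ, 1 ≤ ξ → StripBoundaryIntegrable d (g α ξ)) ∧
    -- the approximant is an exponential sum with `N = N_- + N_+ + 1` terms
    (∀ ε : ℝ, 0 < ε → ε < 1 → ∃ w b : Fin (numTerms α d ε) → ℝ,
      (∀ j, 0 < w j ∧ 0 < b j) ∧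
      ∀ ξ : ℝ, 1 ≤ ξ → approx α d ε ξ = ((∑ j, w j * Real.exp (-(b j) * ξ) : ℝ) : ℂ)) ∧
    -- error bound for every `ε ∈ (0, 1)`
    (∀ ε : ℝ, 0 < ε → ε < 1 → ∀ ξ : ℝ, 1 ≤ ξ →
      err α d ε ξ ≤ (Real.Gamma (α + 1))⁻¹ *
        (stripNorm d (g α ξ) / (1 - ε) + 1 / step d ε
          + 1 / (beta α d * step d ε ^ (1 / α))) * ε) ∧
    -- error bounds for `ε < exp(-π²/4)`
    (∀ ε : ℝ, 0 < ε → ε < Real.exp (-(Real.pi ^ 2 / 4)) → ∀ ξ : ℝ, 1 ≤ ξ →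
      err α d ε ξ ≤
        (stripNorm d (g α ξ) + 1 / step d ε + 1 / (beta α d * step d ε ^ (1 / α))) * ε ∧
      err α d ε ξ ≤
        2 * (1 + Real.log 2 + Real.Gamma (α + 1) / Real.cos (Real.pi / 8) ^ α
          + (Real.cos (Real.pi / 4))⁻¹
            * (4 * Real.log ε⁻¹ / (Real.pi ^ 2 * α)) ^ (1 / α)) * ε) ∧
    -- asymptotics of the number of terms, as `ε → 0+`
    Asymptotics.IsEquivalent (nhdsWithin (0 : ℝ) (Set.Ioi 0))
      (fun ε => (numTerms α d ε : ℝ)) (fun ε => Real.log ε⁻¹ ^ 2 / (2 * Real.pi * d)) ∧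
    Asymptotics.IsEquivalent (nhdsWithin (0 : ℝ) (Set.Ioi 0))
      (fun ε => Real.log ε⁻¹) (fun ε => Real.sqrt (2 * Real.pi * d * numTerms α d ε)) ∧
    -- accuracy in terms of the number of terms, uniformly in `ξ`
    (∃ C : ℝ, 0 < C ∧ ∀ ε : ℝ, 0 < ε → ε < Real.exp (-(Real.pi ^ 2 / 4)) →
      Real.exp (-Real.sqrt (2 * Real.pi * d * numTerms α d ε)) ≤ ε ∧
      ε ≤ Real.exp (-Real.sqrt (2 * Real.pi * d * numTerms α d ε)
        + C * (numTerms α d ε : ℝ) ^ (α / 2)) ∧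
      ∀ ξ : ℝ, 1 ≤ ξ → err α d ε ξ ≤
        C * Real.exp (-Real.sqrt (2 * Real.pi * d * numTerms α d ε)
          + C * (numTerms α d ε : ℝ) ^ (α / 2))) := by
  refine ⟨cos_pi_div_four_le_beta hα0 hd0 hd,
    fun ξ hξ => stripBoundaryIntegrable_g hα0 hα1 hd0 hd hξ, fun ε h0 h1 => ?_,
    fun ε h0 h1 ξ hξ => err_le hα0 hα1 hd0 hd h0 h1 hξ,
    fun ε h0 hε ξ hξ => ⟨err_le_norm_of_small hα0 hα1 hd0 hd h0 hε hξ,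
      err_le_log_of_small hα0 hα1 hd0 hd h0 hε hξ⟩,
    numTerms_isEquivalent hα0 hα1 hd0 hd, log_inv_isEquivalent hα0 hα1 hd0 hd,
    exists_accuracy_constant hα0 hα1 hd0 hd⟩
  obtain ⟨w, b, hpos, hsum⟩ := exists_exponential_sum hα0 (step_pos hd0 h0 h1)
  exact ⟨w, b, hpos, fun ξ _ => hsum ξ⟩
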